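/- Let $N$ be a simply connected Lie group whose Lie algebra $\mathfrak n$ is 2-step nilpotent, i.e. $[\mathfrak n,[\mathfrak n,\mathfrak n]]=0$, endowed with a left-invariant pseudo-Riemannian metric; let $\langle\cdot,\cdot\rangle$ be the induced non-degenerate symmetric bilinear form on $\mathfrak n = T_eN$. Assume that the center $\mathfrak z$ of $\mathfrak n$ is a non-degenerate subspace, put $\mathfrak v=\mathfrak z^\perp$, and let $j:\mathfrak z\to\mathfrak{so}(\mathfrak v)$ be the linear map determined by $$\langle j(Z)X,Y\rangle=\langle [X,Y],Z\rangle\qquad (X,Y\in\mathfrak v,\ Z\in\mathfrak z).$$ Let $V_0\subset T_eN$ be the maximal subspace on which the holonomy group at $e$ of the Levi-Civita connection of $N$ acts trivially. One says that $N$ has a (non-trivial) flat de Rham–Wu factor if $V_0\neq\{0\}$ and $V_0$ is non-degenerate, and that it has no flat de Rham–Wu factor otherwise. Then the following are equivalent: 1. $j$ is injective; 2. $[\mathfrak n,\mathfrak n]$ is a non-degenerate subspace of $\mathfrak n$ and $N$ has no flat de Rham–Wu factor. -/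

import Mathlib

open scoped Manifold ContDiff

set_option linter.unusedSectionVars false

/-- A smooth real Lie group is regular enough for its tangent space at `1` to be a Lie algebra. -/
instance leInfty_minSmoothness_three : ENat.LEInfty (minSmoothness ℝ 3) :=
  ⟨by rw [minSmoothness_of_isRCLikeNormedField]; exact ENat.LEInfty.out⟩

section MetricLieAlgebra

variable {L : Type*} [LieRing L] [LieAlgebra ℝ L]

/-- The center of a Lie algebra, as a linear subspace. -/
def centerSubspace (L : Type*) [LieRing L] [LieAlgebra ℝ L] : Submodule ℝ L :=
  (LieAlgebra.center ℝ L).toSubmodule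

/-- The commutator `[L, L]` (linear span of all brackets), as a linear subspace. -/
def commutatorSubspace (L : Type*) [LieRing L] [LieAlgebra ℝ L] : Submodule ℝ L :=
  (⁅(⊤ : LieIdeal ℝ L), (⊤ : LieIdeal ℝ L)⁆ : LieIdeal ℝ L).toSubmodule

/-- `W` is a non-degenerate subspace: the restriction of `B` to `W` is non-degenerate. -/
def IsNondegenerateSubspace (B : LinearMap.BilinForm ℝ L) (W : Submodule ℝ L) : Prop :=
  (B.restrict W).Nondegenerate

/-- The orthogonal complement `𝔳 = 𝔷^⊥` of the center. -/
def vSubspace (B : LinearMap.BilinForm ℝ L) : Submodule ℝ L :=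
  B.orthogonal (centerSubspace L)

variable [FiniteDimensional ℝ L] {B : LinearMap.BilinForm ℝ L}

theorem vSubspace_nondegenerate 
    (hs : B.IsSymm) (hB : B.Nondegenerate)
    (hz : IsNondegenerateSubspace B (centerSubspace L)) :
    IsNondegenerateSubspace B (vSubspace B) := by
  have hr := hs.isRefl
  unfold IsNondegenerateSubspace
  rw [LinearMap.BilinForm.restrict_nondegenerate_iff_isCompl_orthogonal hr]
  unfold vSubspace
  rw [LinearMap.BilinForm.orthogonal_orthogonal hB hr]
  exact (LinearMap.BilinForm.isCompl_orthogonal_of_restrict_nondegenerate hr hz).symm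

/-- The vector `j(Z)X ∈ 𝔳`, determined by `⟨j(Z)X, Y⟩ = ⟨[X, Y], Z⟩` for all `Y ∈ 𝔳`. -/
noncomputable def jVec (hv : IsNondegenerateSubspace B (vSubspace B)) (Z : L) (X : vSubspace B) :
    vSubspace B :=
  ((B.restrict (vSubspace B)).toDual hv).symm
    { toFun := fun Y => B ⁅(X : L), (Y : L)⁆ Z
      map_add' := fun Y Y' => by simp
      map_smul' := fun a Y => by simp }

theorem jVec_spec (hv : IsNondegenerateSubspace B (vSubspace B)) (Z : L) (X Y : vSubspace B) :
    B (jVec hv Z X) Y = B ⁅(X : L), (Y : L)⁆ Z :=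
  LinearMap.BilinForm.apply_toDual_symm_apply (B := B.restrict (vSubspace B)) (hB := hv) _ Y

theorem eq_of_forall_restrict {W : Submodule ℝ L} (hW : IsNondegenerateSubspace B W) {X X' : W}
    (h : ∀ Y : W, B X Y = B X' Y) : X = X' :=
  ((B.restrict W).toDual hW).injective (LinearMap.ext fun Y => h Y)

/-- The linear map `j : 𝔷 → 𝔰𝔬(𝔳)` of a metric Lie algebra with non-degenerate center,
`⟨j(Z)X, Y⟩ = ⟨[X, Y], Z⟩`. -/
noncomputable def jMap (hs : B.IsSymm) (hB : B.Nondegenerate)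
    (hz : IsNondegenerateSubspace B (centerSubspace L)) :
    centerSubspace L →ₗ[ℝ] skewAdjointLieSubalgebra (B.restrict (vSubspace B)) where
  toFun Z := ⟨
    { toFun := jVec (vSubspace_nondegenerate hs hB hz) Z
      map_add' := fun X X' => eq_of_forall_restrict (vSubspace_nondegenerate hs hB hz) fun Y => by simp [jVec_spec]
      map_smul' := fun a X => eq_of_forall_restrict (vSubspace_nondegenerate hs hB hz) fun Y => by simp [jVec_spec] }, by
    change _ ∈ (B.restrict (vSubspace B)).skewAdjointSubmodule
    rw [LinearMap.mem_skewAdjointSubmodule]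
    intro X Y
    change B (jVec (vSubspace_nondegenerate hs hB hz) Z X) Y = B X (-(jVec (vSubspace_nondegenerate hs hB hz) Z Y : L))
    rw [map_neg, hs.eq X, jVec_spec, jVec_spec, ← lie_skew (X : L) (Y : L), map_neg,
      LinearMap.neg_apply]⟩
  map_add' Z Z' := Subtype.ext <| LinearMap.ext fun X => eq_of_forall_restrict (vSubspace_nondegenerate hs hB hz) fun Y => by
    change B (jVec (vSubspace_nondegenerate hs hB hz) _ X) Y = B (jVec (vSubspace_nondegenerate hs hB hz) Z X + jVec (vSubspace_nondegenerate hs hB hz) Z' X : L) Y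
    simp [jVec_spec]
  map_smul' a Z := Subtype.ext <| LinearMap.ext fun X => eq_of_forall_restrict (vSubspace_nondegenerate hs hB hz) fun Y => by
    change B (jVec (vSubspace_nondegenerate hs hB hz) _ X) Y = B (a • jVec (vSubspace_nondegenerate hs hB hz) Z X : L) Y
    simp [jVec_spec]

theorem jMap_spec (hs : B.IsSymm) (hB : B.Nondegenerate)
    (hz : IsNondegenerateSubspace B (centerSubspace L)) (Z : centerSubspace L)
    (X Y : vSubspace B) :
    B ((jMap hs hB hz Z : Module.End ℝ (vSubspace B)) X : L) Y = B ⁅(X : L), (Y : L)⁆ Z :=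
  jVec_spec (vSubspace_nondegenerate hs hB hz) Z X Y

/-- The vector `∇_X Y` for left-invariant fields `X`, `Y`, given by Koszul's formula
`2⟨∇_X Y, W⟩ = ⟨[X, Y], W⟩ - ⟨[Y, W], X⟩ + ⟨[W, X], Y⟩`. -/
noncomputable def koszulVec (hB : B.Nondegenerate) (X Y : L) : L :=
  (B.toDual hB).symm
    { toFun := fun W => (1 / 2 : ℝ) * (B ⁅X, Y⁆ W - B ⁅Y, W⁆ X + B ⁅W, X⁆ Y)
      map_add' := fun W W' => by simp; ring
      map_smul' := fun a W => by simp; ring }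

theorem koszulVec_spec (hB : B.Nondegenerate) (X Y W : L) :
    B (koszulVec hB X Y) W = (1 / 2 : ℝ) * (B ⁅X, Y⁆ W - B ⁅Y, W⁆ X + B ⁅W, X⁆ Y) :=
  LinearMap.BilinForm.apply_toDual_symm_apply _ _

theorem eq_of_forall_form (hB : B.Nondegenerate) {X X' : L}
    (h : ∀ Y : L, B X Y = B X' Y) : X = X' :=
  (B.toDual hB).injective (LinearMap.ext fun Y => h Y)

/-- Koszul's formula as a bilinear map `(X, Y) ↦ ∇_X Y` on the Lie algebra. -/
noncomputable def koszul (hB : B.Nondegenerate) : L →ₗ[ℝ] L →ₗ[ℝ] L :=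
  LinearMap.mk₂ ℝ (koszulVec hB)
    (fun X X' Y => eq_of_forall_form hB fun W => by simp [koszulVec_spec]; ring)
    (fun a X Y => eq_of_forall_form hB fun W => by simp [koszulVec_spec]; ring)
    (fun X Y Y' => eq_of_forall_form hB fun W => by simp [koszulVec_spec]; ring)
    (fun a X Y => eq_of_forall_form hB fun W => by simp [koszulVec_spec]; ring)

theorem koszul_spec (hB : B.Nondegenerate) (X Y W : L) :
    B (koszul hB X Y) W = (1 / 2 : ℝ) * (B ⁅X, Y⁆ W - B ⁅Y, W⁆ X + B ⁅W, X⁆ Y) :=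
  koszulVec_spec hB X Y W

theorem koszul_sub (hB : B.Nondegenerate) (X Y : L) :
    koszul hB X Y - koszul hB Y X = ⁅X, Y⁆ :=
  eq_of_forall_form hB fun W => by
    rw [map_sub, LinearMap.sub_apply, koszul_spec, koszul_spec, ← lie_skew X Y, ← lie_skew X W,
      ← lie_skew W Y]
    simp only [map_neg, LinearMap.neg_apply]; ring

theorem koszul_skew (hs : B.IsSymm) (hB : B.Nondegenerate) (X Y W : L) :
    B (koszul hB X Y) W + B Y (koszul hB X W) = 0 := by
  rw [hs.eq Y, koszul_spec, koszul_spec, ← lie_skew W X, ← lie_skew Y W, ← lie_skew Y X]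
  simp only [map_neg, LinearMap.neg_apply]; ring

end MetricLieAlgebra

noncomputable section
variable {E : Type*} [NormedAddCommGroup E] [NormedSpace ℝ E] [FiniteDimensional ℝ E]
  {N : Type*} [TopologicalSpace N] [ChartedSpace E N] [Group N] [LieGroup 𝓘(ℝ, E) ∞ N]

instance finiteDimensional_groupLieAlgebra : FiniteDimensional ℝ (GroupLieAlgebra 𝓘(ℝ, E) N) :=
  inferInstanceAs (FiniteDimensional ℝ E)

instance t2Space_groupLieAlgebra : T2Space (GroupLieAlgebra 𝓘(ℝ, E) N) :=
  inferInstanceAs (T2Space E)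

/-- The differential at `1` of left translation by `x`. -/
def leftTranslation (x : N) : GroupLieAlgebra 𝓘(ℝ, E) N →L[ℝ] TangentSpace 𝓘(ℝ, E) x :=
  mfderiv 𝓘(ℝ, E) 𝓘(ℝ, E) (x * ·) (1 : N)

/-- The Maurer-Cartan form: the differential at `x` of left translation by `x⁻¹`. -/
def maurerCartan (x : N) : TangentSpace 𝓘(ℝ, E) x →L[ℝ] GroupLieAlgebra 𝓘(ℝ, E) N :=
  mfderiv 𝓘(ℝ, E) 𝓘(ℝ, E) (x⁻¹ * ·) x

theorem leftTranslation_apply (x : N) (v : GroupLieAlgebra 𝓘(ℝ, E) N) :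
    leftTranslation x v = mulInvariantVectorField v x := rfl

theorem mdiff_mul_left (a x : N) : MDifferentiableAt 𝓘(ℝ, E) 𝓘(ℝ, E) (a * ·) x :=
  (contMDiff_mul_left (I := 𝓘(ℝ, E)) (n := ∞) (a := a)).contMDiffAt.mdifferentiableAt (by simp)

/-- The differential of left translation by `a`, with all tangent spaces read as the model `E`. -/
def dL (a x : N) : E →L[ℝ] E := mfderiv 𝓘(ℝ, E) 𝓘(ℝ, E) (a * ·) x

theorem dL_comp (a b c x y : N) (hy : y = b * x) (hc : c = a * b) (u : E) :
    dL a y (dL b x u) = dL c x u := by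
  subst hy hc
  have h : (a * b * · : N → N) = (a * ·) ∘ (b * ·) := by ext y; simp [mul_assoc]
  unfold dL
  rw [h, mfderiv_comp x (mdiff_mul_left a (b * x)) (mdiff_mul_left b x)]
  rfl

theorem dL_one (x : N) (u : E) : dL 1 x u = u := by
  unfold dL
  have h : ((1 : N) * · : N → N) = id := by ext y; simp
  rw [h, mfderiv_id]
  rfl

theorem maurerCartan_leftTranslation (x : N) (v : GroupLieAlgebra 𝓘(ℝ, E) N) :
    maurerCartan x (leftTranslation x v) = v := 
  (dL_comp (E := E) x⁻¹ x 1 1 x (by simp) (by simp) v).trans (dL_one _ _)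

theorem leftTranslation_maurerCartan (x : N) (u : TangentSpace 𝓘(ℝ, E) x) :
    leftTranslation x (maurerCartan x u) = u := 
  (dL_comp (E := E) x x⁻¹ 1 x 1 (by simp) (by simp) u).trans (dL_one _ _)

/-- The left-invariant pseudo-Riemannian metric on `N` whose value at the identity is `B`. -/
def leftInvariantMetric (B : LinearMap.BilinForm ℝ (GroupLieAlgebra 𝓘(ℝ, E) N)) (x : N)
    (u v : TangentSpace 𝓘(ℝ, E) x) : ℝ :=
  B (maurerCartan x u) (maurerCartan x v)

theorem leftInvariantMetric_one (B : LinearMap.BilinForm ℝ (GroupLieAlgebra 𝓘(ℝ, E) N))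
    (u v : GroupLieAlgebra 𝓘(ℝ, E) N) : leftInvariantMetric B 1 u v = B u v := by
  have h : ∀ w : GroupLieAlgebra 𝓘(ℝ, E) N, maurerCartan 1 w = w := fun w =>
    (congrArg (fun a : N => dL (E := E) a 1 w) inv_one).trans (dL_one (E := E) 1 w)
  rw [leftInvariantMetric, h, h]

theorem leftInvariantMetric_mul_left (B : LinearMap.BilinForm ℝ (GroupLieAlgebra 𝓘(ℝ, E) N))
    (a x : N) (u v : TangentSpace 𝓘(ℝ, E) x) :
    leftInvariantMetric B (a * x) (mfderiv 𝓘(ℝ, E) 𝓘(ℝ, E) (a * ·) x u)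
      (mfderiv 𝓘(ℝ, E) 𝓘(ℝ, E) (a * ·) x v) = leftInvariantMetric B x u v := by
  have h : ∀ w : TangentSpace 𝓘(ℝ, E) x,
      maurerCartan (a * x) (mfderiv 𝓘(ℝ, E) 𝓘(ℝ, E) (a * ·) x w) = maurerCartan x w := fun w =>
    dL_comp (E := E) (a * x)⁻¹ a x⁻¹ x (a * x) rfl (by simp) w
  rw [leftInvariantMetric, h, h]
  rfl

/-- The coordinates `y ↦ (dL_y)⁻¹ σ(y)` of a vector field in the left-invariant frame. -/
def frameCoord (σ : ∀ x : N, TangentSpace 𝓘(ℝ, E) x) (x : N) : E := maurerCartan x (σ x)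

theorem mdifferentiableAt_frameCoord {σ : ∀ x : N, TangentSpace 𝓘(ℝ, E) x} {x : N}
    (hσ : MDiffAt (T% σ) x) :
    MDifferentiableAt 𝓘(ℝ, E) 𝓘(ℝ, E) (frameCoord σ) x := by
  let F₁ : N → (TangentBundle 𝓘(ℝ, E) N × TangentBundle 𝓘(ℝ, E) N) :=
    fun y ↦ (⟨y⁻¹, 0⟩, ⟨y, σ y⟩)
  have S₁ : MDiffAt F₁ x := by
    refine MDifferentiableAt.prodMk ?_ hσ
    have h0 := Bundle.mdifferentiableAt_zeroSection ℝ (TangentSpace 𝓘(ℝ, E) : N → Type _)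
      (IB := 𝓘(ℝ, E)) (F := E) (x := x⁻¹)
    have hi : MDifferentiableAt 𝓘(ℝ, E) 𝓘(ℝ, E) (fun y : N => y⁻¹) x :=
      (contMDiff_inv 𝓘(ℝ, E) ∞).contMDiffAt.mdifferentiableAt (by simp)
    exact h0.comp x hi
  let F₂ : (TangentBundle 𝓘(ℝ, E) N × TangentBundle 𝓘(ℝ, E) N) →
      TangentBundle (𝓘(ℝ, E).prod 𝓘(ℝ, E)) (N × N) :=
    (equivTangentBundleProd 𝓘(ℝ, E) N 𝓘(ℝ, E) N).symm
  have S₂ : CMDiff 1 F₂ := contMDiff_equivTangentBundleProd_symm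
  let F₃ : TangentBundle (𝓘(ℝ, E).prod 𝓘(ℝ, E)) (N × N) → TangentBundle 𝓘(ℝ, E) N :=
    tangentMap% (fun (p : N × N) ↦ p.1 * p.2)
  have S₃ : CMDiff 1 F₃ := by
    apply ContMDiff.contMDiff_tangentMap _ (m := 1) (n := 2) le_rfl
    exact contMDiff_mul 𝓘(ℝ, E) 2
  have S : MDiffAt (F₃ ∘ F₂ ∘ F₁) x :=
    ((S₃.comp S₂).mdifferentiable one_ne_zero _).comp x S₁
  have hF : F₃ ∘ F₂ ∘ F₁ = fun y => (⟨1, maurerCartan y (σ y)⟩ : TangentBundle 𝓘(ℝ, E) N) := by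
    funext y
    have h1 : y⁻¹ * y = 1 := inv_mul_cancel y
    simp only [Function.comp_apply, tangentMap, F₃, F₂, F₁]
    rw [mfderiv_prod_eq_add_apply ((contMDiff_mul 𝓘(ℝ, E) ∞).mdifferentiable (by simp) _)]
    refine (Bundle.TotalSpace.mk.injEq _ _ _ _).mpr ⟨h1, heq_of_eq ?_⟩
    exact (congrArg (fun w : E => w + dL (E := E) y⁻¹ y (σ y)) (map_zero (mfderiv 𝓘(ℝ, E) 𝓘(ℝ, E)
      (fun z : N => z * y) y⁻¹))).trans (zero_add _)
  rw [hF, mdifferentiableAt_totalSpace] at S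
  refine S.2.congr_of_eventuallyEq (Filter.Eventually.of_forall fun y => ?_)
  have h1 : (1 : N) ∈ (chartAt E (1 : N)).source := mem_chart_source E 1
  have h2 := (tangentBundleCore 𝓘(ℝ, E) N).coordChange_self (achart E (1 : N)) 1 h1
    (frameCoord σ y)
  exact h2.symm

/-- The derivative at `x` of the coordinates of a vector field in the left-invariant frame. -/
def frameDeriv (σ : ∀ x : N, TangentSpace 𝓘(ℝ, E) x) (x : N) :
    TangentSpace 𝓘(ℝ, E) x →L[ℝ] GroupLieAlgebra 𝓘(ℝ, E) N :=
  mvfderiv 𝓘(ℝ, E) (frameCoord σ) x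

theorem frameDeriv_add {σ σ' : ∀ x : N, TangentSpace 𝓘(ℝ, E) x} {x : N}
    (hσ : MDiffAt (T% σ) x) (hσ' : MDiffAt (T% σ') x) :
    frameDeriv (σ + σ') x = frameDeriv σ x + frameDeriv σ' x := by
  have h : frameCoord (σ + σ') = frameCoord σ + frameCoord σ' := by
    ext y; exact map_add (maurerCartan y) _ _
  unfold frameDeriv
  rw [h, mvfderiv_add (mdifferentiableAt_frameCoord hσ) (mdifferentiableAt_frameCoord hσ')]
  rfl

theorem frameDeriv_smul {σ : ∀ x : N, TangentSpace 𝓘(ℝ, E) x} {f : N → ℝ} {x : N}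
    (hσ : MDiffAt (T% σ) x) (hf : MDiffAt f x) :
    frameDeriv (f • σ) x =
      f x • frameDeriv σ x + (mvfderiv 𝓘(ℝ, E) f x).smulRight (maurerCartan x (σ x)) := by
  have h : frameCoord (f • σ) = f • frameCoord σ := by
    ext y; exact map_smul (maurerCartan y) _ _
  unfold frameDeriv
  rw [h, mvfderiv_smul hf (mdifferentiableAt_frameCoord hσ)]
  rfl

/-- The Levi-Civita connection of the left-invariant metric with value `B` at the identity. For a
vector field `σ` with coordinates `s` in the left-invariant frame it is
`∇_u σ = dL_x (ds(u) + ∇_{u} s(x))`, the last term being given by Koszul's formula. It is a covariant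
derivative, and `leviCivita_torsion` and `leviCivita_metric` show that it is torsion free and metric. -/
def leviCivita {B : LinearMap.BilinForm ℝ (GroupLieAlgebra 𝓘(ℝ, E) N)} (hB : B.Nondegenerate) :
    CovariantDerivative 𝓘(ℝ, E) E (TangentSpace 𝓘(ℝ, E) : N → Type _) where
  toFun σ x := leftTranslation x ∘L (frameDeriv σ x +
      ((koszul hB).flip (maurerCartan x (σ x))).toContinuousLinearMap ∘L maurerCartan x)
  isCovariantDerivativeOnUniv :=
    { add := by
        intro σ σ' x hσ hσ' _
        rw [frameDeriv_add hσ hσ']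
        ext u
        simp
        abel
      leibniz := by
        intro σ f x hσ hf _
        rw [frameDeriv_smul hσ hf]
        ext u
        simp [leftTranslation_maurerCartan]
        abel }

theorem leviCivita_apply {B : LinearMap.BilinForm ℝ (GroupLieAlgebra 𝓘(ℝ, E) N)}
    (hB : B.Nondegenerate) (σ : ∀ x : N, TangentSpace 𝓘(ℝ, E) x) (x : N)
    (u : TangentSpace 𝓘(ℝ, E) x) :
    leviCivita hB σ x u = leftTranslation x
      (frameDeriv σ x u + koszul hB (maurerCartan x u) (maurerCartan x (σ x))) := rfl

theorem frameDeriv_mulInvariantVectorField (v : GroupLieAlgebra 𝓘(ℝ, E) N) (x : N) :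
    frameDeriv (mulInvariantVectorField v) x = 0 := by
  have h : frameCoord (mulInvariantVectorField v) = fun _ : N => (v : E) := by
    ext y; exact maurerCartan_leftTranslation y v
  unfold frameDeriv
  rw [h]
  exact mvfderiv_const (F := E) (v : E)

theorem leviCivita_mulInvariantVectorField
    {B : LinearMap.BilinForm ℝ (GroupLieAlgebra 𝓘(ℝ, E) N)}
    (hB : B.Nondegenerate) (u v : GroupLieAlgebra 𝓘(ℝ, E) N) (x : N) :
    leviCivita hB (mulInvariantVectorField v) x (mulInvariantVectorField u x) =
      mulInvariantVectorField (koszul hB u v) x := by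
  rw [leviCivita_apply, frameDeriv_mulInvariantVectorField, ← leftTranslation_apply,
    ← leftTranslation_apply, maurerCartan_leftTranslation, maurerCartan_leftTranslation]
  simp [leftTranslation_apply]

theorem leviCivita_torsion
    {B : LinearMap.BilinForm ℝ (GroupLieAlgebra 𝓘(ℝ, E) N)}
    (hB : B.Nondegenerate) : (leviCivita hB).torsion = 0 := by
  ext x u v
  rw [← leftTranslation_maurerCartan x u, ← leftTranslation_maurerCartan x v,
    leftTranslation_apply, leftTranslation_apply, CovariantDerivative.torsion_apply,
    leviCivita_mulInvariantVectorField, leviCivita_mulInvariantVectorField,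
    ← mulInvariantVector_mlieBracket, ← GroupLieAlgebra.bracket_def, ← koszul_sub hB]
  · simp [← leftTranslation_apply]
  · exact mdifferentiableAt_mulInvariantVectorField _
  · exact mdifferentiableAt_mulInvariantVectorField _

theorem leviCivita_metric 
    {B : LinearMap.BilinForm ℝ (GroupLieAlgebra 𝓘(ℝ, E) N)} (hs : B.IsSymm)
    (hB : B.Nondegenerate) {σ τ : ∀ x : N, TangentSpace 𝓘(ℝ, E) x} {x : N}
    (hσ : MDiffAt (T% σ) x) (hτ : MDiffAt (T% τ) x) (u : TangentSpace 𝓘(ℝ, E) x) :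
    mvfderiv 𝓘(ℝ, E) (fun y => leftInvariantMetric B y (σ y) (τ y)) x u =
      leftInvariantMetric B x (leviCivita hB σ x u) (τ x) +
      leftInvariantMetric B x (σ x) (leviCivita hB τ x u) := by
  let b : E →L[ℝ] E →L[ℝ] ℝ := LinearMap.toContinuousLinearMap
    ((LinearMap.toContinuousLinearMap : (E →ₗ[ℝ] ℝ) ≃ₗ[ℝ] (E →L[ℝ] ℝ)).toLinearMap ∘ₗ
      (B : E →ₗ[ℝ] E →ₗ[ℝ] ℝ))
  have key : mvfderiv 𝓘(ℝ, E) (fun y => leftInvariantMetric B y (σ y) (τ y)) x u =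
      B (frameDeriv σ x u) (maurerCartan x (τ x)) +
        B (maurerCartan x (σ x)) (frameDeriv τ x u) := by
    have h1 := (mdifferentiableAt_frameCoord hσ).hasMFDerivAt
    have h2 := (mdifferentiableAt_frameCoord hτ).hasMFDerivAt
    have h3 : HasMFDerivAt 𝓘(ℝ, E) 𝓘(ℝ, ℝ)
        (fun y => b (frameCoord σ y) (frameCoord τ y)) x _ :=
      ⟨(b.continuous₂.continuousAt.comp (h1.1.prodMk h2.1)),
        b.hasFDerivWithinAt_of_bilinear h1.2 h2.2⟩
    have h4 : mfderiv 𝓘(ℝ, E) 𝓘(ℝ, ℝ) (fun y => leftInvariantMetric B y (σ y) (τ y)) x = _ :=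
      h3.mfderiv
    unfold mvfderiv
    rw [h4]
    simp only [OpenPartialHomeomorph.extend, mfld_simps]
    exact add_comm _ _
  rw [key]
  have h := koszul_skew hs hB (maurerCartan x u) (maurerCartan x (σ x)) (maurerCartan x (τ x))
  simp only [leftInvariantMetric, leviCivita_apply, maurerCartan_leftTranslation, map_add,
    LinearMap.add_apply]
  linear_combination -h

section Holonomy
variable (D : CovariantDerivative 𝓘(ℝ, E) E (TangentSpace 𝓘(ℝ, E) : N → Type _))

/-- The velocity of a curve `c : [0, 1] → N` (one-sided at the end points). -/
def velocity (c : ℝ → N) (t : ℝ) : TangentSpace 𝓘(ℝ, E) (c t) :=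
  mfderivWithin 𝓘(ℝ, ℝ) 𝓘(ℝ, E) c (Set.Icc 0 1) t (1 : ℝ)

/-- The vector field `V(t) = X_{v(t)}(c(t))` along `c : [0, 1] → N` is `D`-parallel. Here `X_w` is the
left-invariant field with value `w` at `1`; every vector field along `c` is uniquely of this form. Its
covariant derivative along `c` is `DV/dt = X_{v'(t)}(c(t)) + D_{c'(t)} X_{v(t)}`. -/
def IsParallelAlong (c : ℝ → N) (v : ℝ → GroupLieAlgebra 𝓘(ℝ, E) N) : Prop :=
  ∀ t ∈ Set.Icc (0 : ℝ) 1, ∃ w : GroupLieAlgebra 𝓘(ℝ, E) N,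
    HasDerivWithinAt v w (Set.Icc 0 1) t ∧
    mulInvariantVectorField w (c t) + D (mulInvariantVectorField (v t)) (c t) (velocity c t) = 0

/-- `A` is the `D`-parallel transport `T_xN → T_yN` along some piecewise `C^1` curve from `x` to `y`
(a finite concatenation of `C^1` curves). -/
inductive IsParallelTransport :
    ∀ x y : N, (TangentSpace 𝓘(ℝ, E) x ≃ₗ[ℝ] TangentSpace 𝓘(ℝ, E) y) → Prop
  | curve (x y : N) (A : TangentSpace 𝓘(ℝ, E) x ≃ₗ[ℝ] TangentSpace 𝓘(ℝ, E) y) (c : ℝ → N)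
      (smooth : ContMDiffOn 𝓘(ℝ, ℝ) 𝓘(ℝ, E) 1 c (Set.Icc 0 1))
      (source : c 0 = x) (target : c 1 = y)
      (parallel : ∀ u : TangentSpace 𝓘(ℝ, E) x, ∃ v : ℝ → GroupLieAlgebra 𝓘(ℝ, E) N,
        IsParallelAlong D c v ∧
        mulInvariantVectorField (v 0) x = u ∧ mulInvariantVectorField (v 1) y = A u) :
      IsParallelTransport x y A
  | concat (x y z : N) (A : TangentSpace 𝓘(ℝ, E) x ≃ₗ[ℝ] TangentSpace 𝓘(ℝ, E) y)
      (A' : TangentSpace 𝓘(ℝ, E) y ≃ₗ[ℝ] TangentSpace 𝓘(ℝ, E) z)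
      (first : IsParallelTransport x y A) (second : IsParallelTransport y z A') :
      IsParallelTransport x z (A.trans A')

variable {D}

theorem velocity_reverse {c : ℝ → N} (hc : ContMDiffOn 𝓘(ℝ, ℝ) 𝓘(ℝ, E) 1 c (Set.Icc 0 1))
    {t : ℝ} (ht : t ∈ Set.Icc (0 : ℝ) 1) :
    velocity (E := E) (fun s => c (1 - s)) t = -velocity (E := E) c (1 - t) := by
  have hm : Set.MapsTo (fun s : ℝ => 1 - s) (Set.Icc 0 1) (Set.Icc 0 1) := by
    intro s hs; constructor <;> linarith [hs.1, hs.2]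
  have hu : UniqueMDiffWithinAt 𝓘(ℝ, ℝ) (Set.Icc (0 : ℝ) 1) t :=
    (uniqueDiffOn_Icc_zero_one t ht).uniqueMDiffWithinAt
  have hd : HasDerivWithinAt (fun s : ℝ => 1 - s) (-1) (Set.Icc 0 1) t :=
    ((hasDerivAt_id t).const_sub 1).hasDerivWithinAt
  have hd' : HasMFDerivWithinAt 𝓘(ℝ, ℝ) 𝓘(ℝ, ℝ) (fun s : ℝ => 1 - s) (Set.Icc 0 1) t _ :=
    hd.hasFDerivWithinAt.hasMFDerivWithinAt
  have h1 : HasMFDerivWithinAt 𝓘(ℝ, ℝ) 𝓘(ℝ, E) c (Set.Icc 0 1) (1 - t) _ :=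
    ((hc.mdifferentiableOn one_ne_zero) (1 - t) (hm ht)).hasMFDerivWithinAt
  have h2 := (h1.comp t hd' hm).mfderivWithin hu
  unfold velocity
  have h3 : mfderivWithin 𝓘(ℝ, ℝ) 𝓘(ℝ, E) (fun s => c (1 - s)) (Set.Icc 0 1) t = _ := h2
  rw [h3]
  have h4 : ∀ T : ℝ →L[ℝ] E, T ((1 : ℝ) • (-1 : ℝ)) = -T 1 := fun T => by
    rw [one_smul, map_neg]
  exact h4 (mfderivWithin 𝓘(ℝ, ℝ) 𝓘(ℝ, E) c (Set.Icc 0 1) (1 - t))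

theorem IsParallelAlong.reverse {c : ℝ → N}
    (hc : ContMDiffOn 𝓘(ℝ, ℝ) 𝓘(ℝ, E) 1 c (Set.Icc 0 1))
    {v : ℝ → GroupLieAlgebra 𝓘(ℝ, E) N} (h : IsParallelAlong D c v) :
    IsParallelAlong D (fun s => c (1 - s)) (fun s => v (1 - s)) := by
  intro t ht
  have hm : Set.MapsTo (fun s : ℝ => 1 - s) (Set.Icc 0 1) (Set.Icc 0 1) := by
    intro s hs; constructor <;> linarith [hs.1, hs.2]
  obtain ⟨w, hw, hp⟩ := h (1 - t) (hm ht)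
  refine ⟨-w, ?_, ?_⟩
  · have hd : HasDerivWithinAt (fun s : ℝ => 1 - s) (-1) (Set.Icc 0 1) t :=
      ((hasDerivAt_id t).const_sub 1).hasDerivWithinAt
    have hw' : HasDerivWithinAt (F := E) v w (Set.Icc 0 1) (1 - t) := hw
    have h1 := HasDerivWithinAt.scomp t hw' hd hm
    have h2 : HasDerivWithinAt (F := E) (fun s => v (1 - s)) (-w) (Set.Icc 0 1) t := by
      have h3 : (-1 : ℝ) • (w : E) = -w := by rw [neg_smul, one_smul]
      rw [← h3]
      exact h1
    exact h2
  · rw [velocity_reverse hc ht, map_neg, ← leftTranslation_apply, map_neg, ← neg_add,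
      leftTranslation_apply]
    exact neg_eq_zero.mpr hp

theorem IsParallelTransport.symm {x y : N}
    {A : TangentSpace 𝓘(ℝ, E) x ≃ₗ[ℝ] TangentSpace 𝓘(ℝ, E) y}
    (h : IsParallelTransport D x y A) : IsParallelTransport D y x A.symm := by
  induction h with
  | curve x y A c smooth source target parallel =>
    have hm : Set.MapsTo (fun s : ℝ => 1 - s) (Set.Icc 0 1) (Set.Icc 0 1) := by
      intro s hs; constructor <;> linarith [hs.1, hs.2]
    refine .curve y x A.symm (fun s => c (1 - s)) ?_ (by simpa) (by simpa) fun u => ?_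
    · exact smooth.comp (contDiff_const.sub contDiff_id).contMDiff.contMDiffOn hm
    · obtain ⟨v, hv, h0, h1⟩ := parallel (A.symm u)
      refine ⟨fun s => v (1 - s), hv.reverse smooth, ?_, ?_⟩
      · simpa using h1
      · simpa using h0
  | concat x y z A A' _ _ h1 h2 => exact .concat z y x A'.symm A.symm h2 h1

theorem isParallelTransport_refl (x : N) :
    IsParallelTransport D x x (LinearEquiv.refl ℝ (TangentSpace 𝓘(ℝ, E) x)) := by
  refine .curve x x _ (fun _ => x) contMDiffOn_const rfl rfl fun u => ?_
  refine ⟨fun _ => maurerCartan x u, fun t ht => ⟨0, hasDerivWithinAt_const (F := E) _ _ _, ?_⟩, ?_, ?_⟩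
  · have hv : velocity (E := E) (fun _ : ℝ => x) t = 0 := by
      unfold velocity
      rw [mfderivWithin_const]
      rfl
    rw [hv, map_zero, ← leftTranslation_apply, map_zero, add_zero]
  · exact leftTranslation_maurerCartan x u
  · exact leftTranslation_maurerCartan x u

variable (D)

/-- The holonomy group of `D` at `x`: all parallel transports along piecewise `C^1` loops at `x`. -/
def holonomyGroup (x : N) :
    Subgroup (TangentSpace 𝓘(ℝ, E) x ≃ₗ[ℝ] TangentSpace 𝓘(ℝ, E) x) where
  carrier := {A | IsParallelTransport D x x A}
  one_mem' := isParallelTransport_refl x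
  mul_mem' := fun {A A'} hA hA' => .concat x x x A' A hA' hA
  inv_mem' := fun hA => hA.symm

/-- The maximal subspace `V_0` of `T_xN` on which the holonomy group at `x` acts trivially. -/
def holonomyFixed (x : N) : Submodule ℝ (TangentSpace 𝓘(ℝ, E) x) where
  carrier := {u | ∀ A ∈ holonomyGroup D x, A u = u}
  zero_mem' := fun A _ => map_zero A
  add_mem' := fun hu hu' A hA => by rw [map_add, hu A hA, hu' A hA]
  smul_mem' := fun a u hu A hA => by rw [map_smul, hu A hA]

end Holonomy

/-- `N` with the left-invariant metric induced by `B` has a non-trivial flat de Rham-Wu factor: the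
maximal subspace of `T_1N` on which the holonomy group acts trivially is non-trivial and
non-degenerate. -/
def HasFlatDeRhamWuFactor {B : LinearMap.BilinForm ℝ (GroupLieAlgebra 𝓘(ℝ, E) N)}
    (hB : B.Nondegenerate) : Prop :=
  holonomyFixed (leviCivita hB) 1 ≠ ⊥ ∧
    IsNondegenerateSubspace B (holonomyFixed (leviCivita hB) 1)

end

/-! ### Algebra of the Koszul product and of the center of a two-step nilpotent metric Lie algebra.
-/

section MetricLieAlgebra

variable {L : Type*} [LieRing L] [LieAlgebra ℝ L]

/-! The crux is the identity `V₀ = 𝔷 ∩ [𝔫, 𝔫]^⊥ = ker j` (`holonomyFixed_eq_centralAnnihilator`,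
`jMap_eq_zero_iff`). Given it, the theorem is linear algebra. If `ker j = 0` then `V₀ = 0`, and the
radical of `[𝔫, 𝔫] ⊆ 𝔷` lies in `ker j`, so `[𝔫, 𝔫]` is non-degenerate. If `[𝔫, 𝔫]` is
non-degenerate, `V₀` is its orthogonal complement in the non-degenerate space `𝔷`, hence
non-degenerate; so it is a flat factor unless it is zero.

For `ker j ⊆ V₀`, Koszul's formula gives `∇_x u = 0` for every `x`, so the left-invariant field of
`u` is parallel and holonomy fixes `u` (`IsParallelTransport.map_leftInvariant`).

For `V₀ ⊆ ker j`, a holonomy-fixed `u` extends to a parallel field near `1`, because transport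
around small triangles in a chart fixes `u`. In the left-invariant frame this field solves `df =
-∇_{θ} f`, with `θ` the Maurer-Cartan form. Symmetry of second derivatives and the Maurer-Cartan
equation then give `[∇_x, ∇_z] u = 0` whenever `[x, z] = 0` (`koszul_comm_of_mem_holonomyFixed`).
Central `z` suffice: two-step nilpotency and the non-degenerate center force `u ∈ 𝔷 ∩ [𝔫, 𝔫]^⊥`
(`mem_centralAnnihilator_of_koszul_comm`). -/

theorem mem_centerSubspace_iff {u : L} : u ∈ centerSubspace L ↔ ∀ x : L, ⁅u, x⁆ = 0 := by
  change u ∈ LieAlgebra.center ℝ L ↔ _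
  rw [LieModule.mem_maxTrivSubmodule]
  refine forall_congr' fun x => ?_
  rw [← lie_skew, neg_eq_zero]

theorem lie_mem_commutatorSubspace (x y : L) : ⁅x, y⁆ ∈ commutatorSubspace L :=
  LieSubmodule.lie_mem_lie (LieSubmodule.mem_top x) (LieSubmodule.mem_top y)

theorem commutatorSubspace_le {W : Submodule ℝ L} (h : ∀ x y : L, ⁅x, y⁆ ∈ W) :
    commutatorSubspace L ≤ W := by
  unfold commutatorSubspace
  rw [LieSubmodule.lieIdeal_oper_eq_linear_span', Submodule.span_le]
  rintro _ ⟨x, _, y, _, rfl⟩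
  exact h x y

theorem eq_zero_of_mem_nondegenerate {B : LinearMap.BilinForm ℝ L} {W : Submodule ℝ L}
    (hW : IsNondegenerateSubspace B W) {u : L} (hu : u ∈ W) (h : ∀ w ∈ W, B u w = 0) : u = 0 :=
  congrArg Subtype.val (hW.1 ⟨u, hu⟩ fun w => h w w.2)

theorem isNondegenerateSubspace_of_forall {B : LinearMap.BilinForm ℝ L} (hs : B.IsSymm)
    {W : Submodule ℝ L} (h : ∀ u ∈ W, (∀ w ∈ W, B u w = 0) → u = 0) :
    IsNondegenerateSubspace B W :=
  ⟨fun u hu => Subtype.ext (h u u.2 fun w hw => hu ⟨w, hw⟩),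
   fun u hu => Subtype.ext (h u u.2 fun w hw => (hs.eq w u).symm.trans (hu ⟨w, hw⟩))⟩

/-- The subspace `𝔷 ∩ [L, L]^⊥`. -/
def centralAnnihilator (B : LinearMap.BilinForm ℝ L) : Submodule ℝ L :=
  centerSubspace L ⊓ B.orthogonal (commutatorSubspace L)

theorem mem_centralAnnihilator_iff {B : LinearMap.BilinForm ℝ L} {u : L} :
    u ∈ centralAnnihilator B ↔ u ∈ centerSubspace L ∧ ∀ x y : L, B ⁅x, y⁆ u = 0 := by
  refine and_congr_right fun _ => ⟨fun h x y => h _ (lie_mem_commutatorSubspace x y), fun h => ?_⟩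
  intro w hw
  exact commutatorSubspace_le (W := LinearMap.ker (B.flip u)) h hw

variable [FiniteDimensional ℝ L] {B : LinearMap.BilinForm ℝ L}

/-- Two of the three Koszul terms contain a bracket with `z`. Thus `∇_z` acts on `𝔳` as `-½ j(z)`,
which lets the Koszul product replace `j` in the algebra below. -/
theorem koszul_of_mem_centerSubspace_left (hB : B.Nondegenerate) {z : L}
    (hz : z ∈ centerSubspace L) (u w : L) :
    B (koszul hB z u) w = -(1 / 2 : ℝ) * B ⁅u, w⁆ z := by
  have h := mem_centerSubspace_iff.1 hz
  rw [koszul_spec, h u, ← lie_skew w z, h w]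
  simp

theorem koszul_of_mem_centerSubspace_right (hB : B.Nondegenerate) {z : L}
    (hz : z ∈ centerSubspace L) (x : L) : koszul hB x z = koszul hB z x := by
  rw [← sub_eq_zero, koszul_sub, ← lie_skew, mem_centerSubspace_iff.1 hz x, neg_zero]

theorem koszul_center_center (hB : B.Nondegenerate) {z z' : L}
    (hz : z ∈ centerSubspace L) (hz' : z' ∈ centerSubspace L) : koszul hB z z' = 0 :=
  eq_of_forall_form hB fun w => by
    rw [koszul_of_mem_centerSubspace_left hB hz, mem_centerSubspace_iff.1 hz' w]
    simp

theorem koszul_eq_zero_of_mem_centralAnnihilator (hB : B.Nondegenerate) {u : L}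
    (hu : u ∈ centralAnnihilator B) (x : L) : koszul hB x u = 0 := by
  obtain ⟨hz, h⟩ := mem_centralAnnihilator_iff.1 hu
  rw [koszul_of_mem_centerSubspace_right hB hz]
  exact eq_of_forall_form hB fun w => by
    rw [koszul_of_mem_centerSubspace_left hB hz, h]; simp

theorem koszul_center_orthogonal (hB : B.Nondegenerate) {z w : L}
    (hz : z ∈ centerSubspace L) (hw : w ∈ centerSubspace L) (u : L) :
    B (koszul hB z u) w = 0 := by
  rw [koszul_of_mem_centerSubspace_left hB hz, ← lie_skew, mem_centerSubspace_iff.1 hw]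
  simp

/-- An image of `j(Z)` annihilated by all `j(Z')` is zero, for a nilpotent algebra of step two with
non-degenerate center. -/
theorem koszul_center_eq_zero (hB : B.Nondegenerate)
    (hc : IsNondegenerateSubspace B (centerSubspace L))
    (nil : ∀ x y w : L, ⁅x, ⁅y, w⁆⁆ = 0) {z u : L} (hz : z ∈ centerSubspace L)
    (h : ∀ w ∈ centerSubspace L, koszul hB w (koszul hB z u) = 0) : koszul hB z u = 0 := by
  -- `∇_z u` is orthogonal to `𝔷`, so it vanishes once it is central.
  refine eq_zero_of_mem_nondegenerate hc (mem_centerSubspace_iff.2 fun y => ?_)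
    fun w hw => koszul_center_orthogonal hB hz hw u
  -- The bracket `[∇_z u, y]` is central by nilpotency, and its product with a central `w` is
  -- `-2⟨∇_w ∇_z u, y⟩ = 0`.
  refine eq_zero_of_mem_nondegenerate hc ?_ fun w hw => ?_
  · exact mem_centerSubspace_iff.2 fun x => by rw [← lie_skew, nil, neg_zero]
  · have h1 := koszul_of_mem_centerSubspace_left hB hw (koszul hB z u) y
    rw [h w hw, map_zero, LinearMap.zero_apply] at h1
    linarith

/-- A vector annihilated by all curvature operators `R(X, Z)` with central `Z` is central and
orthogonal to the commutator. -/
theorem mem_centralAnnihilator_of_koszul_comm (hs : B.IsSymm) (hB : B.Nondegenerate)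
    (hc : IsNondegenerateSubspace B (centerSubspace L))
    (nil : ∀ x y w : L, ⁅x, ⁅y, w⁆⁆ = 0) {u : L}
    (h : ∀ x : L, ∀ z ∈ centerSubspace L,
      koszul hB x (koszul hB z u) = koszul hB z (koszul hB x u)) : u ∈ centralAnnihilator B := by
  have skew : ∀ x y w : L, B (koszul hB x y) w = - B y (koszul hB x w) := fun x y w => by
    linarith [koszul_skew hs hB x y w]
  -- Pairing the hypothesis with `w` and moving the outer operators across by skew-symmetry.
  have h' : ∀ x w : L, ∀ z ∈ centerSubspace L,
      B (koszul hB z u) (koszul hB x w) = B (koszul hB x u) (koszul hB z w) := by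
    intro x w z hz
    have := congrArg (fun a => B a w) (h x z hz)
    simp only [skew _ (koszul hB _ _)] at this
    linarith
  -- For central `w` one has `∇_z w = 0` and `∇_x w = ∇_w x`, so `h'` says that `∇_w ∇_z u` is
  -- orthogonal to every `x`.
  have h1 : ∀ z ∈ centerSubspace L, koszul hB z u = 0 := by
    intro z hz
    refine koszul_center_eq_zero hB hc nil hz fun w hw => eq_of_forall_form hB fun x => ?_
    have := h' x w z hz
    rw [koszul_center_center hB hz hw, map_zero, koszul_of_mem_centerSubspace_right hB hw] at this
    rw [skew, this]; simp
  have hu : u ∈ centerSubspace L := by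
    refine mem_centerSubspace_iff.2 fun x => eq_zero_of_mem_nondegenerate hc ?_ fun z hz => ?_
    · exact mem_centerSubspace_iff.2 fun y => by rw [← lie_skew, nil, neg_zero]
    · have h2 := koszul_of_mem_centerSubspace_left hB hz u x
      rw [h1 z hz, map_zero, LinearMap.zero_apply] at h2
      linarith
  refine mem_centralAnnihilator_iff.2 ⟨hu, fun x y => ?_⟩
  -- Now that `u` is central, `∇_x u = ∇_u x`, and `h'` with `∇_z u = 0` gives `∇_z ∇_u x = 0`; the
  -- same vanishing criterion applies, with `u` as the central vector.
  have h2 : koszul hB u x = 0 := by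
    refine koszul_center_eq_zero hB hc nil hu fun z hz => eq_of_forall_form hB fun w => ?_
    have := h' x w z hz
    rw [h1 z hz, koszul_of_mem_centerSubspace_right hB hu] at this
    rw [skew, ← this]; simp
  have h3 := koszul_of_mem_centerSubspace_left hB hu x y
  rw [h2, map_zero, LinearMap.zero_apply] at h3
  linarith

theorem exists_add_center (hs : B.IsSymm)
    (hz : IsNondegenerateSubspace B (centerSubspace L)) (x : L) :
    ∃ v ∈ vSubspace B, ∃ z ∈ centerSubspace L, v + z = x := by
  have h := LinearMap.BilinForm.isCompl_orthogonal_of_restrict_nondegenerate hs.isRefl hz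
  have hx : x ∈ vSubspace B ⊔ centerSubspace L := by
    have : vSubspace B ⊔ centerSubspace L = ⊤ := h.symm.sup_eq_top
    rw [this]; trivial
  exact Submodule.mem_sup.1 hx

/-- Since `𝔫 = 𝔳 ⊕ 𝔷`, a bracket depends only on the `𝔳`-components, so testing `⟨[X, Y], z⟩` on `𝔳`
is the same as testing it on `𝔫`. -/
theorem jMap_eq_zero_iff (hs : B.IsSymm) (hB : B.Nondegenerate)
    (hz : IsNondegenerateSubspace B (centerSubspace L)) (z : centerSubspace L) :
    jMap hs hB hz z = 0 ↔ (z : L) ∈ centralAnnihilator B := by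
  rw [mem_centralAnnihilator_iff]
  constructor
  · refine fun h => ⟨z.2, fun x y => ?_⟩
    obtain ⟨v, hv, c, hc, rfl⟩ := exists_add_center hs hz x
    obtain ⟨v', hv', c', hc', rfl⟩ := exists_add_center hs hz y
    have h1 := jMap_spec hs hB hz z ⟨v, hv⟩ ⟨v', hv'⟩
    rw [h] at h1
    have h2 : ⁅v, c'⁆ = 0 := by rw [← lie_skew, mem_centerSubspace_iff.1 hc', neg_zero]
    rw [add_lie, mem_centerSubspace_iff.1 hc, lie_add, h2, add_zero, add_zero]
    exact h1.symm.trans (by simp)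
  · rintro ⟨_, h⟩
    refine Subtype.ext <| LinearMap.ext fun X =>
      eq_of_forall_restrict (vSubspace_nondegenerate hs hB hz) fun Y => ?_
    rw [jMap_spec, h]
    simp

theorem jMap_injective_iff (hs : B.IsSymm) (hB : B.Nondegenerate)
    (hz : IsNondegenerateSubspace B (centerSubspace L)) :
    Function.Injective (jMap hs hB hz) ↔ centralAnnihilator B = ⊥ := by
  rw [injective_iff_map_eq_zero, Submodule.eq_bot_iff]
  constructor
  · intro h u hu
    exact congrArg Subtype.val (h ⟨u, hu.1⟩ ((jMap_eq_zero_iff hs hB hz _).2 hu))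
  · intro h z hj
    exact Subtype.ext (h z ((jMap_eq_zero_iff hs hB hz z).1 hj))

omit [FiniteDimensional ℝ L] in
theorem commutatorSubspace_le_center (nil : ∀ x y w : L, ⁅x, ⁅y, w⁆⁆ = 0) :
    commutatorSubspace L ≤ centerSubspace L :=
  commutatorSubspace_le fun x y =>
    mem_centerSubspace_iff.2 fun w => by rw [← lie_skew, nil, neg_zero]

omit [FiniteDimensional ℝ L] in
theorem isNondegenerateSubspace_commutator (hs : B.IsSymm)
    (nil : ∀ x y w : L, ⁅x, ⁅y, w⁆⁆ = 0) (h : centralAnnihilator B = ⊥) :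
    IsNondegenerateSubspace B (commutatorSubspace L) := by
  refine isNondegenerateSubspace_of_forall hs fun u hu hw => ?_
  refine (Submodule.eq_bot_iff _).1 h u ⟨commutatorSubspace_le_center nil hu, fun w hw' => ?_⟩
  exact (hs.eq _ _).symm.trans (hw w hw')

/-- Non-degeneracy of `[𝔫, 𝔫] ⊆ 𝔷` splits `𝔷` orthogonally as `[𝔫, 𝔫] ⊕ (𝔷 ∩ [𝔫, 𝔫]^⊥)`, so a
radical vector of the second summand is orthogonal to all of `𝔷`. -/
theorem isNondegenerateSubspace_centralAnnihilator (hs : B.IsSymm)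
    (nil : ∀ x y w : L, ⁅x, ⁅y, w⁆⁆ = 0)
    (hz : IsNondegenerateSubspace B (centerSubspace L))
    (hc : IsNondegenerateSubspace B (commutatorSubspace L)) :
    IsNondegenerateSubspace B (centralAnnihilator B) := by
  refine isNondegenerateSubspace_of_forall hs fun u hu hw => ?_
  refine eq_zero_of_mem_nondegenerate hz hu.1 fun w hwz => ?_
  have h := LinearMap.BilinForm.isCompl_orthogonal_of_restrict_nondegenerate hs.isRefl hc
  have hx : w ∈ commutatorSubspace L ⊔ B.orthogonal (commutatorSubspace L) := by
    rw [h.sup_eq_top]; trivial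
  obtain ⟨c, hc', o, ho, rfl⟩ := Submodule.mem_sup.1 hx
  have hoz : o ∈ centerSubspace L := by
    have := Submodule.sub_mem _ hwz (commutatorSubspace_le_center nil hc')
    simpa using this
  rw [map_add, hw o ⟨hoz, ho⟩, add_zero, hs.eq]
  exact hu.2 c hc'

end MetricLieAlgebra

/-! ### Linear differential equations on the unit interval. -/

section LinearODE

variable {F : Type*} [NormedAddCommGroup F] [NormedSpace ℝ F]

/-- The bound `1 / 2` lets one Picard-Lindelöf step cover `[0, 1]`: on the ball of radius `‖x₀‖`
about `x₀` the field has norm at most `½ · 2‖x₀‖`, so no solution leaves the ball in unit time. -/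
theorem exists_linear_ode_solution [CompleteSpace F] {A : ℝ → F →L[ℝ] F}
    (hA : ContinuousOn A (Set.Icc 0 1)) (hb : ∀ t ∈ Set.Icc (0 : ℝ) 1, ‖A t‖ ≤ 1 / 2) (x₀ : F) :
    ∃ α : ℝ → F, α 0 = x₀ ∧
      ∀ t ∈ Set.Icc (0 : ℝ) 1, HasDerivWithinAt α (A t (α t)) (Set.Icc 0 1) t := by
  have h : IsPicardLindelof (fun t x => A t x) (tmin := 0) (tmax := 1) ⟨0, by simp⟩ x₀
      ‖x₀‖₊ 0 ‖x₀‖₊ (1 / 2) :=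
    { lipschitzOnWith := fun t ht => by
        refine ((A t).lipschitz.weaken ?_).lipschitzOnWith
        rw [← NNReal.coe_le_coe]
        simpa using hb t ht
      continuousOn := fun x _ => hA.clm_apply continuousOn_const
      norm_le := fun t ht x hx => by
        have h1 : ‖x‖ ≤ ‖x₀‖ + ‖x₀‖ := by
          have h2 := mem_closedBall_iff_norm.1 hx
          have h3 : ‖x‖ ≤ ‖x - x₀‖ + ‖x₀‖ := by simpa using norm_add_le (x - x₀) x₀
          simp only [coe_nnnorm] at h2
          linarith
        calc ‖A t x‖ ≤ ‖A t‖ * ‖x‖ := (A t).le_opNorm x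
          _ ≤ 1 / 2 * (‖x₀‖ + ‖x₀‖) := by gcongr; exact hb t ht
          _ = ‖x₀‖ := by ring
      mul_max_le := by simp }
  exact h.exists_eq_forall_mem_Icc_hasDerivWithinAt₀

/-- The fundamental solution of a small linear equation on `[0, 1]`. -/
theorem exists_fundamental_solution [FiniteDimensional ℝ F] {A : ℝ → F →L[ℝ] F}
    (hA : ContinuousOn A (Set.Icc 0 1)) (hb : ∀ t ∈ Set.Icc (0 : ℝ) 1, ‖A t‖ ≤ 1 / 2) :
    ∃ T : F ≃ₗ[ℝ] F, ∀ u : F, ∃ α : ℝ → F, α 0 = u ∧ α 1 = T u ∧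
      ∀ t ∈ Set.Icc (0 : ℝ) 1, HasDerivWithinAt α (A t (α t)) (Set.Icc 0 1) t := by
  have : CompleteSpace F := FiniteDimensional.complete ℝ F
  let l := ContinuousLinearMap.compL ℝ F F F
  obtain ⟨Φ, hΦ0, hΦ⟩ := exists_linear_ode_solution (A := fun t => l (A t))
    (l.continuous.comp_continuousOn hA)
    (fun t ht => (ContinuousLinearMap.opNorm_le_bound _ (norm_nonneg _) fun T =>
      (A t).opNorm_comp_le T).trans (hb t ht)) (ContinuousLinearMap.id ℝ F)
  -- `Ψ` solves the adjoint equation `Ψ' = -ΨA`, so `ΨΦ` is constant and `Ψ 1` is a left inverse of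
  -- `Φ 1`.
  obtain ⟨Ψ, hΨ0, hΨ⟩ := exists_linear_ode_solution (A := fun t => l.flip (-A t))
    (l.flip.continuous.comp_continuousOn hA.neg)
    (fun t ht => (ContinuousLinearMap.opNorm_le_bound _ (norm_nonneg _) fun T => by
      have := T.opNorm_comp_le (-A t)
      rw [norm_neg, mul_comm] at this
      exact this).trans (hb t ht)) (ContinuousLinearMap.id ℝ F)
  have hc : ∀ t ∈ Set.Icc (0 : ℝ) 1,
      HasDerivWithinAt (fun s => (Ψ s).comp (Φ s)) 0 (Set.Icc 0 1) t := by
    intro t ht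
    have h := (hΨ t ht).clm_comp (hΦ t ht)
    convert h using 1
    ext u
    simp [l]
  have hone : (Ψ 1).comp (Φ 1) = ContinuousLinearMap.id ℝ F := by
    have h := norm_image_sub_le_of_norm_deriv_le_segment_01' hc (C := 0) (by simp)
    have h' := sub_eq_zero.1 (norm_le_zero_iff.1 h)
    rw [h', hΨ0, hΦ0, ContinuousLinearMap.id_comp]
  have hinj : Function.Injective (Φ 1).toLinearMap :=
    Function.LeftInverse.injective (g := Ψ 1) fun u => by
      simpa using congrArg (fun T : F →L[ℝ] F => T u) hone
  refine ⟨LinearEquiv.ofInjectiveEndo (Φ 1).toLinearMap hinj,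
    fun u => ⟨fun t => Φ t u, by simp [hΦ0], by simp, fun t ht => ?_⟩⟩
  have h := (hΦ t ht).clm_apply (hasDerivWithinAt_const t (Set.Icc (0 : ℝ) 1) u)
  simpa [l] using h

theorem norm_le_mul_exp_of_linear_ode {A : ℝ → F →L[ℝ] F} {K : ℝ}
    (hb : ∀ t ∈ Set.Icc (0 : ℝ) 1, ‖A t‖ ≤ K) {α : ℝ → F}
    (hα : ∀ t ∈ Set.Icc (0 : ℝ) 1, HasDerivWithinAt α (A t (α t)) (Set.Icc 0 1) t)
    {t : ℝ} (ht : t ∈ Set.Icc (0 : ℝ) 1) : ‖α t‖ ≤ ‖α 0‖ * Real.exp (K * t) := by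
  have h := norm_le_gronwallBound_of_norm_deriv_right_le (f := α) (f' := fun s => A s (α s))
    (δ := ‖α 0‖) (K := K) (ε := 0) (a := 0) (b := 1)
    (fun s hs => (hα s hs).continuousWithinAt)
    (fun s hs => (hα s (Set.Ico_subset_Icc_self hs)).mono_of_mem_nhdsWithin
      (Icc_mem_nhdsGE_of_mem hs)) le_rfl
    (fun s hs => by
      rw [add_zero]
      exact ((A s).le_opNorm _).trans
        (mul_le_mul_of_nonneg_right (hb s (Set.Ico_subset_Icc_self hs)) (norm_nonneg _))) t ht
  rwa [gronwallBound_ε0, sub_zero] at h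

end LinearODE

/-! ### Parallel sections of a connection form and their integrability condition. -/

section FlatSection

variable {E F G : Type*} [NormedAddCommGroup E] [NormedSpace ℝ E]
  [NormedAddCommGroup F] [NormedSpace ℝ F] [NormedAddCommGroup G] [NormedSpace ℝ G]

/-- A function that is transported along all short segments by the linear equation with
connection form `act ∘ Γ` is differentiable and solves `df = act (Γ) f`. -/
theorem hasFDerivAt_of_segment_transport {Γ : E → E →L[ℝ] G} (act : G →L[ℝ] F →L[ℝ] F)
    {f : E → F} {p : E} (hΓ : ContinuousAt Γ p)
    (hf : ∀ᶠ q in nhds p, ∃ α : ℝ → F, α 0 = f p ∧ α 1 = f q ∧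
      ∀ t ∈ Set.Icc (0 : ℝ) 1,
        HasDerivWithinAt α (act (Γ (p + t • (q - p)) (q - p)) (α t)) (Set.Icc 0 1) t) :
    HasFDerivAt f ((act.flip (f p)).comp (Γ p)) p := by
  obtain ⟨κ, hκ, hact⟩ : ∃ κ : ℝ, 0 < κ ∧ ∀ g, ‖act g‖ ≤ κ * ‖g‖ := act.bound
  rw [hasFDerivAt_iff_isLittleO, Asymptotics.isLittleO_iff]
  intro c hc
  -- Grönwall bound for `α` on the whole segment, valid once `C * ‖q - p‖ ≤ 1`.
  set M := ‖f p‖ * Real.exp 1 with hM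
  have hM0 : 0 ≤ M := by positivity
  set C := κ * (‖Γ p‖ + 1) with hC
  have hC0 : 0 < C := by positivity
  -- The remainder has two sources, the variation of `Γ` (at most `ε`) and that of `α` (at most `C *
  -- r * M`); `ε` here and `r` below give each half of `c`. Using `M + 1` avoids division by zero
  -- when `f p = 0`.
  obtain ⟨ε, hε, hε1, hεc⟩ : ∃ ε : ℝ, 0 < ε ∧ ε ≤ 1 ∧ κ * ε * (M + 1) ≤ c / 2 := by
    refine ⟨min 1 (c / 2 / (κ * (M + 1))), by positivity, min_le_left _ _, ?_⟩
    calc κ * min 1 (c / 2 / (κ * (M + 1))) * (M + 1)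
        ≤ κ * (c / 2 / (κ * (M + 1))) * (M + 1) := by
          gcongr; exact min_le_right _ _
      _ = c / 2 := by field_simp
  have hΓε : ∀ᶠ q in nhds p, ‖Γ q - Γ p‖ < ε :=
    (hΓ.sub continuousAt_const).norm.eventually_lt continuousAt_const (by simpa using hε)
  obtain ⟨δ, hδ, hδΓ⟩ := Metric.eventually_nhds_iff.1 hΓε
  obtain ⟨r, hr, hrC, hrc⟩ : ∃ r : ℝ, 0 < r ∧ C * r ≤ 1 ∧ C * (C * r * (M + 1)) ≤ c / 2 := by
    refine ⟨min (1 / C) (c / 2 / (C * (C * (M + 1)))), by positivity, ?_, ?_⟩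
    · calc C * min (1 / C) (c / 2 / (C * (C * (M + 1)))) ≤ C * (1 / C) := by
            gcongr; exact min_le_left _ _
        _ = 1 := by field_simp
    · calc C * (C * min (1 / C) (c / 2 / (C * (C * (M + 1)))) * (M + 1))
          ≤ C * (C * (c / 2 / (C * (C * (M + 1)))) * (M + 1)) := by
            gcongr; exact min_le_right _ _
        _ = c / 2 := by field_simp
  filter_upwards [hf, Metric.ball_mem_nhds p hδ, Metric.ball_mem_nhds p hr] with q hq hqδ hqr
  obtain ⟨α, h0, h1, hα⟩ := hq
  set w := q - p with hw
  rw [Metric.mem_ball, dist_eq_norm] at hqδ hqr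
  have hΓd : ∀ t ∈ Set.Icc (0 : ℝ) 1, ‖Γ (p + t • w) - Γ p‖ ≤ ε := by
    intro t ht
    refine (hδΓ ?_).le
    rw [dist_eq_norm, add_sub_cancel_left, norm_smul, Real.norm_of_nonneg ht.1]
    calc t * ‖w‖ ≤ 1 * ‖w‖ := by gcongr; exact ht.2
      _ < δ := by rwa [one_mul]
  have hbound : ∀ (T : E →L[ℝ] G) (K : ℝ), ‖T‖ ≤ K → ‖act (T w)‖ ≤ κ * K * ‖w‖ := by
    intro T K hT
    calc ‖act (T w)‖ ≤ κ * ‖T w‖ := hact _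
      _ ≤ κ * (K * ‖w‖) := by gcongr; exact T.le_of_opNorm_le hT w
      _ = κ * K * ‖w‖ := by ring
  have hΓC : ∀ t ∈ Set.Icc (0 : ℝ) 1, ‖act (Γ (p + t • w) w)‖ ≤ C * ‖w‖ := by
    intro t ht
    refine hbound _ _ ?_
    have := norm_add_le (Γ (p + t • w) - Γ p) (Γ p)
    rw [sub_add_cancel] at this
    linarith [hΓd t ht]
  have hCw : C * ‖w‖ ≤ 1 := le_trans (by gcongr) hrC
  have hαM : ∀ t ∈ Set.Icc (0 : ℝ) 1, ‖α t‖ ≤ M := by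
    intro t ht
    refine (norm_le_mul_exp_of_linear_ode (A := fun t => act (Γ (p + t • w) w)) hΓC hα ht).trans ?_
    rw [h0, hM]
    gcongr
    calc C * ‖w‖ * t ≤ 1 * 1 := by gcongr; exacts [ht.1, ht.2]
      _ = 1 := one_mul 1
  have hαd : ∀ t ∈ Set.Icc (0 : ℝ) 1, ‖α t - f p‖ ≤ C * r * M := by
    intro t ht
    have := norm_image_sub_le_of_norm_deriv_le_segment' hα (C := C * r * M) (fun s hs => by
      have hs' := Set.Ico_subset_Icc_self hs
      refine (ContinuousLinearMap.le_opNorm _ _).trans ?_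
      have := hΓC s hs'
      exact mul_le_mul (this.trans (by gcongr)) (hαM s hs') (norm_nonneg _) (by positivity)) t ht
    rw [h0, sub_zero] at this
    refine this.trans (mul_le_of_le_one_right (by positivity) ht.2)
  -- Mean value inequality for `α` minus its linear approximation; the values at `0` and `1` give
  -- the first-order remainder of `f`.
  have key := norm_image_sub_le_of_norm_deriv_le_segment_01'
    (f := fun t => α t - t • act (Γ p w) (f p))
    (f' := fun t => act (Γ (p + t • w) w) (α t) - act (Γ p w) (f p)) (C := c * ‖w‖)
    (fun t ht => by
      have := (hα t ht).sub ((hasDerivWithinAt_id t (Set.Icc (0 : ℝ) 1)).smul_const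
        (act (Γ p w) (f p)))
      simpa using! this)
    (fun t ht => by
      have ht' := Set.Ico_subset_Icc_self ht
      have e : act (Γ (p + t • w) w) (α t) - act (Γ p w) (f p) =
          act ((Γ (p + t • w) - Γ p) w) (α t) + act (Γ p w) (α t - f p) := by simp
      rw [e]
      have b1 : ‖act ((Γ (p + t • w) - Γ p) w) (α t)‖ ≤ κ * ε * ‖w‖ * M :=
        (ContinuousLinearMap.le_opNorm _ _).trans
          (mul_le_mul (hbound _ _ (hΓd t ht')) (hαM t ht') (norm_nonneg _) (by positivity))
      have b2 : ‖act (Γ p w) (α t - f p)‖ ≤ C * ‖w‖ * (C * r * M) :=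
        (ContinuousLinearMap.le_opNorm _ _).trans
          (mul_le_mul (hbound _ _ (le_add_of_nonneg_right zero_le_one)) (hαd t ht')
            (norm_nonneg _) (by positivity))
      calc _ ≤ κ * ε * ‖w‖ * M + C * ‖w‖ * (C * r * M) :=
            (norm_add_le _ _).trans (add_le_add b1 b2)
        _ ≤ κ * ε * ‖w‖ * (M + 1) + C * ‖w‖ * (C * r * (M + 1)) := by gcongr <;> linarith
        _ = (κ * ε * (M + 1) + C * (C * r * (M + 1))) * ‖w‖ := by ring
        _ ≤ c * ‖w‖ := by gcongr; linarith)
  simp only [h1, h0, one_smul, zero_smul, sub_zero] at key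
  rw [ContinuousLinearMap.comp_apply, ContinuousLinearMap.flip_apply, sub_right_comm]
  exact key

/-- The integrability condition of the equation `df = act (Γ) f`. -/
theorem symmetric_of_flat_section {Γ : E → E →L[ℝ] G} (act : G →L[ℝ] F →L[ℝ] F)
    {f : E → F} {p : E} (hΓ : DifferentiableAt ℝ Γ p)
    (hf : ∀ᶠ q in nhds p, HasFDerivAt f ((act.flip (f q)).comp (Γ q)) q) (v w : E) :
    act (fderiv ℝ Γ p v w) (f p) + act (Γ p w) (act (Γ p v) (f p)) =
      act (fderiv ℝ Γ p w v) (f p) + act (Γ p v) (act (Γ p w) (f p)) := by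
  -- The equation itself makes `df` differentiable, so `Γ` need only be differentiable at `p`.
  have h1 : HasFDerivAt (fun q => act.flip (f q)) _ p :=
    act.flip.hasFDerivAt.comp p hf.self_of_nhds
  have h := second_derivative_symmetric_of_eventually hf (h1.clm_comp hΓ.hasFDerivAt) v w
  simpa [add_comm] using h

end FlatSection

theorem differentiableAt_of_forall_apply {D F G : Type*} [NormedAddCommGroup D] [NormedSpace ℝ D]
    [NormedAddCommGroup F] [NormedSpace ℝ F] [FiniteDimensional ℝ F]
    [NormedAddCommGroup G] [NormedSpace ℝ G] {f : D → F →L[ℝ] G} {p : D}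
    (h : ∀ w, DifferentiableAt ℝ (fun q => f q w) p) : DifferentiableAt ℝ f p := by
  let d := Module.finrank ℝ F
  have hd : d = Module.finrank ℝ (Fin d → ℝ) := (Module.finrank_fin_fun ℝ).symm
  let e₁ := ContinuousLinearEquiv.ofFinrankEq hd
  let e₂ := (e₁.arrowCongr (1 : G ≃L[ℝ] G)).trans (ContinuousLinearEquiv.piRing (Fin d))
  rw [← Function.id_comp f, ← e₂.symm_comp_self]
  exact e₂.symm.differentiableAt.comp p (differentiableAt_pi.2 fun i => h _)

/-! ### The Maurer-Cartan form in the chart at the identity. -/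

noncomputable section
variable {E : Type*} [NormedAddCommGroup E] [NormedSpace ℝ E] [FiniteDimensional ℝ E]
  {N : Type*} [TopologicalSpace N] [ChartedSpace E N] [Group N] [LieGroup 𝓘(ℝ, E) ∞ N]

instance isManifold_one_of_lieGroup : IsManifold 𝓘(ℝ, E) 1 N :=
  IsManifold.of_le (n := ∞) (by simp)

variable (E N) in
/-- The preferred chart at the identity. -/
def chartOne : PartialEquiv N E := extChartAt 𝓘(ℝ, E) (1 : N)

variable (E N) in
/-- The differential of the inverse of the chart at the identity. -/
def chartOneSymmDeriv (p : E) : E →L[ℝ] E :=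
  mfderivWithin 𝓘(ℝ, E) 𝓘(ℝ, E) (chartOne E N).symm (Set.range 𝓘(ℝ, E)) p

variable (E N) in
/-- The Maurer-Cartan form in the chart at the identity. -/
def chartForm (p : E) : E →L[ℝ] E :=
  (dL ((chartOne E N).symm p)⁻¹ ((chartOne E N).symm p)).comp (chartOneSymmDeriv E N p)

theorem isOpen_chartOne_target : IsOpen (chartOne E N).target := isOpen_extChartAt_target 1

theorem mdifferentiableAt_chartOne_symm {p : E} (hp : p ∈ (chartOne E N).target) :
    MDifferentiableAt 𝓘(ℝ, E) 𝓘(ℝ, E) (chartOne E N).symm p :=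
  ((contMDiffOn_extChartAt_symm (I := 𝓘(ℝ, E)) (n := 1) (1 : N)).contMDiffAt
    (isOpen_chartOne_target.mem_nhds hp)).mdifferentiableAt one_ne_zero

/-- Applied to a fixed `w`, the form gives the left-invariant frame coordinates of the field that is
constant in the tangent bundle trivialization at `1`; these are differentiable because the field is.
-/
theorem differentiableAt_chartForm {p : E} (hp : p ∈ (chartOne E N).target) :
    DifferentiableAt ℝ (chartForm E N) p := by
  refine differentiableAt_of_forall_apply fun w => ?_
  let e := trivializationAt E (TangentSpace 𝓘(ℝ, E) : N → Type _) 1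
  let σ : ∀ x : N, TangentSpace 𝓘(ℝ, E) x := fun x => e.symmL ℝ x w
  have hsrc : ∀ q ∈ (chartOne E N).target, (chartOne E N).symm q ∈ (chartAt E (1 : N)).source := by
    intro q hq
    have := (chartOne E N).map_target hq
    rwa [chartOne, extChartAt_source] at this
  set x := (chartOne E N).symm p with hx
  have hxb : x ∈ e.baseSet := hsrc p hp
  have hσ : MDiffAt (T% σ) x := by
    rw [e.mdifferentiableAt_section_iff 𝓘(ℝ, E) _ hxb]
    refine (mdifferentiableAt_const (c := w)).congr_of_eventuallyEq ?_
    filter_upwards [e.open_baseSet.mem_nhds hxb] with y hy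
    have h0 : σ y = e.symm y w := e.symmL_apply hy w
    rw [h0, e.apply_mk_symm hy w]
  have h1 := (mdifferentiableAt_frameCoord hσ).comp p (mdifferentiableAt_chartOne_symm hp)
  refine h1.differentiableAt.congr_of_eventuallyEq ?_
  filter_upwards [isOpen_chartOne_target.mem_nhds hp] with q hq
  have h2 := TangentBundle.symmL_trivializationAt (I := 𝓘(ℝ, E)) (hsrc q hq)
  have h3 : extChartAt 𝓘(ℝ, E) (1 : N) ((chartOne E N).symm q) = q := (chartOne E N).right_inv hq
  have h4 : σ ((chartOne E N).symm q) = chartOneSymmDeriv E N q w := by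
    rw [h3] at h2
    exact congrArg (fun T : E →L[ℝ] E => T w) h2
  exact congrArg (dL ((chartOne E N).symm q)⁻¹ ((chartOne E N).symm q)) h4.symm


theorem isInvertible_chartOneSymmDeriv {p : E} (hp : p ∈ (chartOne E N).target) :
    (chartOneSymmDeriv E N p).IsInvertible :=
  isInvertible_mfderivWithin_extChartAt_symm hp

theorem dL_inv_dL (x : N) (u : E) : dL x⁻¹ x (dL x 1 u) = u :=
  (dL_comp (E := E) x⁻¹ x 1 1 x (by simp) (by simp) u).trans (dL_one _ _)

theorem dL_dL_inv (x : N) (u : E) : dL x 1 (dL x⁻¹ x u) = u :=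
  (dL_comp (E := E) x x⁻¹ 1 x 1 (by simp) (by simp) u).trans (dL_one _ _)

theorem isInvertible_chartForm {p : E} (hp : p ∈ (chartOne E N).target) :
    (chartForm E N p).IsInvertible := by
  refine ContinuousLinearMap.IsInvertible.comp ?_ (isInvertible_chartOneSymmDeriv hp)
  exact ContinuousLinearMap.IsInvertible.of_inverse (g := dL ((chartOne E N).symm p) 1)
    (ContinuousLinearMap.ext fun u => dL_inv_dL _ u)
    (ContinuousLinearMap.ext fun u => dL_dL_inv _ u)

variable (N) in
/-- The left-invariant vector field with value `u` at the identity, in the chart there. -/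
def chartField (u : E) (p : E) : E := (chartForm E N p).inverse u

theorem chartForm_chartField {p : E} (hp : p ∈ (chartOne E N).target) (u : E) :
    chartForm E N p (chartField N u p) = u := by
  obtain ⟨e, he⟩ := isInvertible_chartForm hp
  rw [chartField, ← he, ContinuousLinearMap.inverse_equiv]
  exact e.apply_symm_apply u

theorem chartField_chartForm {p : E} (hp : p ∈ (chartOne E N).target) (u : E) :
    chartField N (chartForm E N p u) p = u := by
  obtain ⟨e, he⟩ := isInvertible_chartForm hp
  rw [chartField, ← he, ContinuousLinearMap.inverse_equiv]
  exact e.symm_apply_apply u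

theorem chartField_eq {p : E} (hp : p ∈ (chartOne E N).target) (u : E) :
    chartField N u p = (chartOneSymmDeriv E N p).inverse (dL ((chartOne E N).symm p) 1 u) := by
  have h : chartForm E N p
      ((chartOneSymmDeriv E N p).inverse (dL ((chartOne E N).symm p) 1 u)) = u := by
    obtain ⟨e, he⟩ := isInvertible_chartOneSymmDeriv hp
    rw [chartForm, ← he, ContinuousLinearMap.inverse_equiv, ContinuousLinearMap.comp_apply]
    exact (congrArg _ (e.apply_symm_apply _)).trans (dL_inv_dL _ u)
  rw [← chartField_chartForm hp ((chartOneSymmDeriv E N p).inverse _), h]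

theorem differentiableAt_chartField {p : E} (hp : p ∈ (chartOne E N).target) (u : E) :
    DifferentiableAt ℝ (chartField N u) p := by
  have : CompleteSpace E := FiniteDimensional.complete ℝ E
  obtain ⟨e, he⟩ := isInvertible_chartForm hp
  have h1 : DifferentiableAt ℝ ContinuousLinearMap.inverse (chartForm E N p) := by
    rw [← he]
    exact (contDiffAt_map_inverse (n := 1) e).differentiableAt one_ne_zero
  exact (h1.comp p (differentiableAt_chartForm hp)).clm_apply (differentiableAt_const u)

theorem chartOne_one_mem : chartOne E N 1 ∈ (chartOne E N).target :=
  mem_extChartAt_target (1 : N)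

/-- The bracket of the group Lie algebra is the manifold bracket at `1`, computed by pulling fields
back through the chart; near the base point these pullbacks are the `chartField`s. -/
theorem lieBracket_chartField {u v : E}
    (h : Bracket.bracket (L := GroupLieAlgebra 𝓘(ℝ, E) N) (M := GroupLieAlgebra 𝓘(ℝ, E) N) u v = 0) :
    VectorField.lieBracket ℝ (chartField N u) (chartField N v) (chartOne E N 1) =
      0 := by
  have h0 : VectorField.mlieBracket 𝓘(ℝ, E) (mulInvariantVectorField (I := 𝓘(ℝ, E)) (G := N) u)
      (mulInvariantVectorField v) (1 : N) = 0 := h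
  rw [← VectorField.mlieBracketWithin_univ, VectorField.mlieBracketWithin_apply] at h0
  obtain ⟨e, he⟩ := isInvertible_mfderiv_extChartAt (I := 𝓘(ℝ, E)) (mem_extChartAt_source (1 : N))
  rw [← he, ContinuousLinearMap.inverse_equiv] at h0
  have h1 := (map_eq_zero_iff _ e.symm.injective).1 h0
  have hE : ∀ w : E, chartField N w =ᶠ[nhds (chartOne E N 1)]
      VectorField.mpullbackWithin 𝓘(ℝ, E) 𝓘(ℝ, E) (extChartAt 𝓘(ℝ, E) (1 : N)).symm
        (mulInvariantVectorField w) (Set.range 𝓘(ℝ, E)) := by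
    intro w
    filter_upwards [isOpen_chartOne_target.mem_nhds chartOne_one_mem] with q hq
    exact chartField_eq hq w
  rw [(hE u).lieBracket_vectorField_eq (hE v)]
  rw [Set.preimage_univ, Set.univ_inter, ModelWithCorners.range_eq_univ] at h1
  rw [ModelWithCorners.range_eq_univ]
  exact (congrFun (VectorField.lieBracketWithin_univ (E := E)).symm _).trans h1

/-- The Maurer-Cartan equation at the identity, for commuting left-invariant fields. -/
theorem fderiv_chartForm_symm {u v : E}
    (h : Bracket.bracket (L := GroupLieAlgebra 𝓘(ℝ, E) N) (M := GroupLieAlgebra 𝓘(ℝ, E) N) u v = 0) :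
    fderiv ℝ (chartForm E N) (chartOne E N 1) (chartField N u (chartOne E N 1))
        (chartField N v (chartOne E N 1)) =
      fderiv ℝ (chartForm E N) (chartOne E N 1) (chartField N v (chartOne E N 1))
        (chartField N u (chartOne E N 1)) := by
  have hp : chartOne E N 1 ∈ (chartOne E N).target := chartOne_one_mem
  -- Differentiating the constant `θ(X_w) = w` turns derivatives of the form into derivatives of the
  -- fields, where the vanishing bracket applies.
  have hd : ∀ w a : E, fderiv ℝ (chartForm E N) (chartOne E N 1) a
      (chartField N w (chartOne E N 1)) =
      -chartForm E N (chartOne E N 1) (fderiv ℝ (chartField N w) (chartOne E N 1) a) := by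
    intro w a
    have h1 := (differentiableAt_chartForm hp).hasFDerivAt.clm_apply
      (differentiableAt_chartField hp w).hasFDerivAt
    have h2 : (fun q => chartForm E N q (chartField N w q)) =ᶠ[nhds (chartOne E N 1)]
        fun _ => w := by
      filter_upwards [isOpen_chartOne_target.mem_nhds hp] with q hq
      exact chartForm_chartField hq w
    have h3 := h1.unique ((hasFDerivAt_const w _).congr_of_eventuallyEq h2)
    have h4 := congrArg (fun T : E →L[ℝ] E => T a) h3
    rw [eq_neg_iff_add_eq_zero, add_comm]
    simpa using h4
  have hb := sub_eq_zero.1 (lieBracket_chartField h)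
  rw [hd, hd, hb]

end

/-! ### Levi-Civita transport along chart segments as a linear equation. -/

noncomputable section
variable {E : Type*} [NormedAddCommGroup E] [NormedSpace ℝ E] [FiniteDimensional ℝ E]
  {N : Type*} [TopologicalSpace N] [ChartedSpace E N] [Group N] [LieGroup 𝓘(ℝ, E) ∞ N]

/-- Left translation as an isomorphism from the model space onto the tangent space. -/
def leftTranslationEquiv (x : N) : E ≃ₗ[ℝ] TangentSpace 𝓘(ℝ, E) x where
  toFun u := leftTranslation x u
  invFun u := maurerCartan x u
  map_add' u v := map_add (leftTranslation x) u v
  map_smul' a u := map_smul (leftTranslation x) a u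
  left_inv u := maurerCartan_leftTranslation x u
  right_inv u := leftTranslation_maurerCartan x u

theorem leftTranslationEquiv_one (u : E) : leftTranslationEquiv (1 : N) u = u :=
  dL_one (E := E) (1 : N) u

theorem leviCivita_leftInvariant {B : LinearMap.BilinForm ℝ (GroupLieAlgebra 𝓘(ℝ, E) N)}
    (hB : B.Nondegenerate) (v : GroupLieAlgebra 𝓘(ℝ, E) N) (x : N) (u : TangentSpace 𝓘(ℝ, E) x) :
    leviCivita hB (mulInvariantVectorField v) x u =
      leftTranslation x (koszul hB (maurerCartan x u) v) := by
  rw [leviCivita_apply, frameDeriv_mulInvariantVectorField, ← leftTranslation_apply,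
    maurerCartan_leftTranslation]
  simp

/-- In the left-invariant frame, parallelism is the linear equation `v' = -∇_{θ(c')} v`. -/
theorem isParallelAlong_leviCivita_iff {B : LinearMap.BilinForm ℝ (GroupLieAlgebra 𝓘(ℝ, E) N)}
    (hB : B.Nondegenerate) {c : ℝ → N} {v : ℝ → GroupLieAlgebra 𝓘(ℝ, E) N} :
    IsParallelAlong (leviCivita hB) c v ↔ ∀ t ∈ Set.Icc (0 : ℝ) 1,
      HasDerivWithinAt (F := E) v (-(koszul hB (maurerCartan (c t) (velocity c t)) (v t)))
        (Set.Icc 0 1) t := by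
  have key : ∀ (t : ℝ) (w : GroupLieAlgebra 𝓘(ℝ, E) N), mulInvariantVectorField w (c t) +
      leviCivita hB (mulInvariantVectorField (v t)) (c t) (velocity c t) = 0 ↔
      w = -(koszul hB (maurerCartan (c t) (velocity c t)) (v t)) := by
    intro t w
    rw [leviCivita_leftInvariant, ← leftTranslation_apply, ← map_add, ← eq_neg_iff_add_eq_zero.symm]
    exact (leftTranslationEquiv (E := E) (c t)).map_eq_zero_iff
  refine forall₂_congr fun t _ => ⟨?_, fun h => ⟨_, h, (key t _).2 rfl⟩⟩
  rintro ⟨w, hw, h⟩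
  rw [← (key t w).1 h]
  exact hw

/-- The bilinear map `(X, Y) ↦ -∇_X Y` of left-invariant fields, on the model space. -/
def negKoszul {B : LinearMap.BilinForm ℝ (GroupLieAlgebra 𝓘(ℝ, E) N)}
    (hB : B.Nondegenerate) : E →L[ℝ] E →L[ℝ] E :=
  LinearMap.toContinuousLinearMap
    ((LinearMap.toContinuousLinearMap : (E →ₗ[ℝ] E) ≃ₗ[ℝ] (E →L[ℝ] E)).toLinearMap ∘ₗ
      (-(koszul hB : E →ₗ[ℝ] E →ₗ[ℝ] E)))

variable (N) in
/-- The curve in `N` that is a segment in the chart at the identity. -/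
def chartSegment (p q : E) (t : ℝ) : N := (chartOne E N).symm (p + t • (q - p))

theorem contMDiffOn_chartSegment {p q : E}
    (h : ∀ t ∈ Set.Icc (0 : ℝ) 1, p + t • (q - p) ∈ (chartOne E N).target) :
    ContMDiffOn 𝓘(ℝ, ℝ) 𝓘(ℝ, E) 1 (chartSegment N p q) (Set.Icc 0 1) := by
  have h1 : ContDiff ℝ 1 fun t : ℝ => p + t • (q - p) := by fun_prop
  exact (contMDiffOn_extChartAt_symm (I := 𝓘(ℝ, E)) (n := 1) (1 : N)).comp
    h1.contMDiff.contMDiffOn h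

theorem velocity_chartSegment {p q : E} {t : ℝ} (ht : t ∈ Set.Icc (0 : ℝ) 1)
    (h : p + t • (q - p) ∈ (chartOne E N).target) :
    (velocity (chartSegment N p q) t : E) = chartOneSymmDeriv E N (p + t • (q - p)) (q - p) := by
  have hu : UniqueMDiffWithinAt 𝓘(ℝ, ℝ) (Set.Icc (0 : ℝ) 1) t :=
    (uniqueDiffOn_Icc_zero_one t ht).uniqueMDiffWithinAt
  have hd : HasDerivWithinAt (fun t : ℝ => p + t • (q - p)) (q - p) (Set.Icc 0 1) t := by
    simpa using ((hasDerivWithinAt_id t (Set.Icc (0 : ℝ) 1)).smul_const (q - p)).const_add p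
  have hd' : HasMFDerivWithinAt 𝓘(ℝ, ℝ) 𝓘(ℝ, E) (fun t : ℝ => p + t • (q - p)) (Set.Icc 0 1) t _ :=
    hd.hasFDerivWithinAt.hasMFDerivWithinAt
  have h1 := (mdifferentiableAt_chartOne_symm h).hasMFDerivAt
  have h2 := (h1.comp_hasMFDerivWithinAt t hd').mfderivWithin hu
  unfold velocity chartOneSymmDeriv
  rw [ModelWithCorners.range_eq_univ, mfderivWithin_univ]
  have h3 : mfderivWithin 𝓘(ℝ, ℝ) 𝓘(ℝ, E) (chartSegment N p q) (Set.Icc 0 1) t = _ := h2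
  rw [h3]
  have h4 : ∀ T : E →L[ℝ] E, T ((1 : ℝ) • (q - p)) = T (q - p) := fun T => by rw [one_smul]
  exact h4 (mfderiv 𝓘(ℝ, E) 𝓘(ℝ, E) (chartOne E N).symm (p + t • (q - p)))

theorem isParallelTransport_chartSegment
    {B : LinearMap.BilinForm ℝ (GroupLieAlgebra 𝓘(ℝ, E) N)} (hB : B.Nondegenerate) {p q : E}
    (h : ∀ t ∈ Set.Icc (0 : ℝ) 1, p + t • (q - p) ∈ (chartOne E N).target) {T : E ≃ₗ[ℝ] E}
    (hT : ∀ u : E, ∃ α : ℝ → E, α 0 = u ∧ α 1 = T u ∧ ∀ t ∈ Set.Icc (0 : ℝ) 1,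
      HasDerivWithinAt α (negKoszul hB (chartForm E N (p + t • (q - p)) (q - p)) (α t))
        (Set.Icc 0 1) t) {x y : N} (hx : (chartOne E N).symm p = x)
    (hy : (chartOne E N).symm q = y) :
    IsParallelTransport (leviCivita hB) x y
      (((leftTranslationEquiv x).symm.trans T).trans (leftTranslationEquiv y)) := by
  refine .curve x y _ (chartSegment N p q) (contMDiffOn_chartSegment h) ?_ ?_ fun u => ?_
  · simpa [chartSegment] using hx
  · simpa [chartSegment] using hy
  obtain ⟨α, h0, h1, hα⟩ := hT ((leftTranslationEquiv x).symm u)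
  refine ⟨α, (isParallelAlong_leviCivita_iff hB).2 fun t ht => ?_, ?_, ?_⟩
  · have h2 : (maurerCartan (chartSegment N p q t) (velocity (E := E) (chartSegment N p q) t) : E) =
        chartForm E N (p + t • (q - p)) (q - p) :=
      congrArg (dL (E := E) (chartSegment N p q t)⁻¹ (chartSegment N p q t))
        (velocity_chartSegment ht (h t ht))
    have h3 := hα t ht
    rw [← h2] at h3
    exact h3
  · rw [h0]
    exact (leftTranslationEquiv x).apply_symm_apply u
  · rw [h1]
    rfl

end

/-! ### From trivial holonomy on a vector to commuting Koszul operators. -/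

noncomputable section
variable {E : Type*} [NormedAddCommGroup E] [NormedSpace ℝ E] [FiniteDimensional ℝ E]
  {N : Type*} [TopologicalSpace N] [ChartedSpace E N] [Group N] [LieGroup 𝓘(ℝ, E) ∞ N]
  {B : LinearMap.BilinForm ℝ (GroupLieAlgebra 𝓘(ℝ, E) N)}

/-- Reads invariance of a vector around a triangle as path independence; the `eᵢ` will be left
translations at the three vertices. -/
theorem comp_eq_of_loop_eq {V V₁ V₂ V₃ : Type*} [AddCommGroup V] [Module ℝ V]
    [AddCommGroup V₁] [Module ℝ V₁] [AddCommGroup V₂] [Module ℝ V₂] [AddCommGroup V₃] [Module ℝ V₃]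
    (e₁ : V ≃ₗ[ℝ] V₁) (e₂ : V ≃ₗ[ℝ] V₂) (e₃ : V ≃ₗ[ℝ] V₃) (T₁₂ T₂₃ T₁₃ : V ≃ₗ[ℝ] V) {u : V₁}
    (h : (((e₁.symm.trans T₁₂).trans e₂).trans ((e₂.symm.trans T₂₃).trans e₃)).trans
      ((e₁.symm.trans T₁₃).trans e₃).symm u = u) :
    T₂₃ (T₁₂ (e₁.symm u)) = T₁₃ (e₁.symm u) := by
  rw [LinearEquiv.trans_apply, LinearEquiv.symm_apply_eq] at h
  simpa using h

/-- Near the identity, parallel transport along segments in the chart. -/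
theorem exists_chartSegment_transport (hB : B.Nondegenerate) :
    ∃ r > 0, Metric.ball (chartOne E N 1) r ⊆ (chartOne E N).target ∧
      ∀ p ∈ Metric.ball (chartOne E N 1) r, ∀ q ∈ Metric.ball (chartOne E N 1) r,
      ∃ T : E ≃ₗ[ℝ] E, ∀ u : E, ∃ α : ℝ → E, α 0 = u ∧ α 1 = T u ∧ ∀ t ∈ Set.Icc (0 : ℝ) 1,
        HasDerivWithinAt α (negKoszul hB (chartForm E N (p + t • (q - p)) (q - p)) (α t))
          (Set.Icc 0 1) t := by
  set p₀ := chartOne E N 1 with hp₀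
  obtain ⟨κ, hκ, hact⟩ : ∃ κ : ℝ, 0 < κ ∧ ∀ g, ‖negKoszul hB g‖ ≤ κ * ‖g‖ := (negKoszul hB).bound
  obtain ⟨r₁, hr₁, h₁⟩ := Metric.isOpen_iff.1 (isOpen_chartOne_target (E := E) (N := N)) p₀
    chartOne_one_mem
  have hcont : ContinuousAt (fun p => ‖chartForm E N p‖) p₀ :=
    (differentiableAt_chartForm chartOne_one_mem).continuousAt.norm
  have hev : ∀ᶠ p in nhds p₀, ‖chartForm E N p‖ < ‖chartForm E N p₀‖ + 1 :=
    hcont.eventually_lt continuousAt_const (lt_add_one _)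
  obtain ⟨r₂, hr₂, h₂⟩ := Metric.eventually_nhds_iff_ball.1 hev
  set C := κ * (‖chartForm E N p₀‖ + 1) with hC
  have hC0 : 0 < C := by positivity
  -- Two points of the ball are at most `2r` apart, so the last condition yields the coefficient
  -- bound `1 / 2` needed for a fundamental solution.
  obtain ⟨r, hr, hr1, hr2, hr3⟩ : ∃ r : ℝ, 0 < r ∧ r ≤ r₁ ∧ r ≤ r₂ ∧ C * (r + r) ≤ 1 / 2 := by
    refine ⟨min r₁ (min r₂ (1 / (4 * C))), by positivity, min_le_left _ _,
      (min_le_right _ _).trans (min_le_left _ _), ?_⟩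
    have : min r₁ (min r₂ (1 / (4 * C))) ≤ 1 / (4 * C) :=
      (min_le_right _ _).trans (min_le_right _ _)
    calc C * (min r₁ (min r₂ (1 / (4 * C))) + min r₁ (min r₂ (1 / (4 * C))))
        ≤ C * (1 / (4 * C) + 1 / (4 * C)) := by gcongr
      _ = 1 / 2 := by field_simp; norm_num
  refine ⟨r, hr, (Metric.ball_subset_ball hr1).trans h₁, fun p hp q hq => ?_⟩
  have hseg : ∀ t ∈ Set.Icc (0 : ℝ) 1, p + t • (q - p) ∈ Metric.ball p₀ r := fun t ht =>
    (convex_ball p₀ r).add_smul_sub_mem hp hq ht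
  have hlen : ‖q - p‖ ≤ r + r := by
    rw [← dist_eq_norm]
    exact (dist_triangle_right q p p₀).trans (add_le_add (le_of_lt hq) (le_of_lt hp))
  refine exists_fundamental_solution
    (A := fun t => negKoszul hB (chartForm E N (p + t • (q - p)) (q - p))) ?_ ?_
  · refine (negKoszul hB).continuous.comp_continuousOn
      (ContinuousOn.clm_apply (fun t ht => ?_) continuousOn_const)
    have h3 := (differentiableAt_chartForm (h₁ (Metric.ball_subset_ball hr1 (hseg t ht)))).continuousAt
    have h4 : ContinuousAt (fun t : ℝ => p + t • (q - p)) t := by fun_prop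
    exact (ContinuousAt.comp (f := fun t : ℝ => p + t • (q - p)) h3 h4).continuousWithinAt
  · intro t ht
    have h3 := (h₂ _ (Metric.ball_subset_ball hr2 (hseg t ht))).le
    calc ‖negKoszul hB (chartForm E N (p + t • (q - p)) (q - p))‖
        ≤ κ * ‖chartForm E N (p + t • (q - p)) (q - p)‖ := hact _
      _ ≤ κ * ((‖chartForm E N p₀‖ + 1) * (r + r)) := by
          gcongr
          exact (ContinuousLinearMap.le_of_opNorm_le _ h3 _).trans (by gcongr)
      _ = C * (r + r) := by ring
      _ ≤ 1 / 2 := hr3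

/-- A vector fixed by the holonomy group is annihilated by the curvature operators of pairs of
commuting left-invariant fields. -/
theorem koszul_comm_of_mem_holonomyFixed (hB : B.Nondegenerate)
    {u : GroupLieAlgebra 𝓘(ℝ, E) N} (hu : u ∈ holonomyFixed (leviCivita hB) (1 : N))
    {x z : GroupLieAlgebra 𝓘(ℝ, E) N} (hxz : ⁅x, z⁆ = 0) :
    koszul hB x (koszul hB z u) = koszul hB z (koszul hB x u) := by
  obtain ⟨r, hr, hsub, hT⟩ := exists_chartSegment_transport (N := N) hB
  set p₀ := chartOne E N 1 with hp₀
  choose! T hT using hT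
  have hmem : p₀ ∈ Metric.ball p₀ r := Metric.mem_ball_self hr
  have htr : ∀ p ∈ Metric.ball p₀ r, ∀ q ∈ Metric.ball p₀ r, ∀ x y : N,
      (chartOne E N).symm p = x → (chartOne E N).symm q = y →
      IsParallelTransport (leviCivita hB) x y
        (((leftTranslationEquiv x).symm.trans (T p q)).trans (leftTranslationEquiv y)) :=
    fun p hp q hq x y hx hy => isParallelTransport_chartSegment hB
      (fun t ht => hsub ((convex_ball p₀ r).add_smul_sub_mem hp hq ht)) (hT p hp q hq) hx hy
  have hone : (chartOne E N).symm p₀ = 1 := (chartOne E N).left_inv (mem_extChartAt_source 1)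
  let u' : E := u
  have hΛ : (leftTranslationEquiv (1 : N)).symm u = u' := by
    rw [LinearEquiv.symm_apply_eq]
    exact (leftTranslationEquiv_one (N := N) u').symm
  -- The loop is the triangle `p₀ → p → q → p₀`, whose transport fixes `u`.
  have hcocycle : ∀ p ∈ Metric.ball p₀ r, ∀ q ∈ Metric.ball p₀ r,
      T p q (T p₀ p u') = T p₀ q u' := by
    intro p hp q hq
    have h := hu _ (((htr p₀ hmem p hp 1 _ hone rfl).concat _ _ _ _ _
      (htr p hp q hq _ _ rfl rfl)).concat _ _ _ _ _ (htr p₀ hmem q hq 1 _ hone rfl).symm)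
    exact hΛ ▸ comp_eq_of_loop_eq _ _ _ _ _ _ h
  -- The degenerate triangle gives `T (T u') = T u'` with `T` injective.
  have hself : T p₀ p₀ u' = u' := (T p₀ p₀).injective (hcocycle p₀ hmem p₀ hmem)
  have hflat : ∀ p ∈ Metric.ball p₀ r, HasFDerivAt (fun q => T p₀ q u')
      (((negKoszul hB).flip (T p₀ p u')).comp (chartForm E N p)) p := by
    intro p hp
    refine hasFDerivAt_of_segment_transport (negKoszul hB)
      (differentiableAt_chartForm (hsub hp)).continuousAt ?_
    filter_upwards [Metric.isOpen_ball.mem_nhds hp] with q hq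
    obtain ⟨α, h0, h1, hα⟩ := hT p hp q hq (T p₀ p u')
    exact ⟨α, h0, h1.trans (hcocycle p hp q hq), hα⟩
  -- Integrability of the parallel section `q ↦ T p₀ q u'` at `p₀`, along the fields of `a` and `b`:
  -- the derivative terms of the form cancel by the Maurer-Cartan equation, leaving the commutator.
  have key : ∀ a b : E, Bracket.bracket (L := GroupLieAlgebra 𝓘(ℝ, E) N)
      (M := GroupLieAlgebra 𝓘(ℝ, E) N) a b = 0 →
      negKoszul hB a (negKoszul hB b u') = negKoszul hB b (negKoszul hB a u') := by
    intro a b hab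
    have h := symmetric_of_flat_section (negKoszul hB)
      (differentiableAt_chartForm (chartOne_one_mem (N := N)))
      (Filter.eventually_of_mem (Metric.ball_mem_nhds p₀ hr) hflat)
      (chartField N a p₀) (chartField N b p₀)
    rw [← hp₀, hp₀, fderiv_chartForm_symm hab, add_right_inj,
      chartForm_chartField chartOne_one_mem, chartForm_chartField chartOne_one_mem, ← hp₀,
      hself] at h
    exact h.symm
  have e : ∀ a b : GroupLieAlgebra 𝓘(ℝ, E) N,
      (negKoszul hB (a : E) (negKoszul hB (b : E) u') : E) = koszul hB a (koszul hB b u) :=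
    fun a b => by
      have : koszul hB a (-(koszul hB b u)) = -(koszul hB a (koszul hB b u)) := map_neg _ _
      exact (congrArg Neg.neg this).trans (neg_neg _)
  exact (e x z).symm.trans ((key x z hxz).trans (e z x))

end

/-! ### Parallel left-invariant fields and the determination of the fixed space. -/

noncomputable section
variable {E : Type*} [NormedAddCommGroup E] [NormedSpace ℝ E] [FiniteDimensional ℝ E]
  {N : Type*} [TopologicalSpace N] [ChartedSpace E N] [Group N] [LieGroup 𝓘(ℝ, E) ∞ N]
  {B : LinearMap.BilinForm ℝ (GroupLieAlgebra 𝓘(ℝ, E) N)}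

theorem bilinForm_eq_of_hasDerivWithinAt (b : LinearMap.BilinForm ℝ E) {v w v' w' : ℝ → E}
    (hv : ∀ t ∈ Set.Icc (0 : ℝ) 1, HasDerivWithinAt v (v' t) (Set.Icc 0 1) t)
    (hw : ∀ t ∈ Set.Icc (0 : ℝ) 1, HasDerivWithinAt w (w' t) (Set.Icc 0 1) t)
    (h : ∀ t, b (v' t) (w t) + b (v t) (w' t) = 0) : b (v 1) (w 1) = b (v 0) (w 0) := by
  let b' : E →L[ℝ] E →L[ℝ] ℝ := LinearMap.toContinuousLinearMap
    ((LinearMap.toContinuousLinearMap : (E →ₗ[ℝ] ℝ) ≃ₗ[ℝ] (E →L[ℝ] ℝ)).toLinearMap ∘ₗ b)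
  have hd : ∀ t ∈ Set.Icc (0 : ℝ) 1,
      HasDerivWithinAt (fun s => b' (v s) (w s)) 0 (Set.Icc 0 1) t := by
    intro t ht
    have h1 := b'.hasDerivWithinAt_of_bilinear (hv t ht) (hw t ht)
    have h2 : b' (v t) (w' t) + b' (v' t) (w t) = 0 := (add_comm _ _).trans (h t)
    rwa [h2] at h1
  have h3 := norm_image_sub_le_of_norm_deriv_le_segment_01' hd (C := 0) (by simp)
  exact sub_eq_zero.1 (norm_le_zero_iff.1 h3)

/-- Skew-symmetry of each `∇_X` makes the product of two parallel fields constant. -/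
theorem IsParallelAlong.form_eq (hs : B.IsSymm) (hB : B.Nondegenerate) {c : ℝ → N}
    {v w : ℝ → GroupLieAlgebra 𝓘(ℝ, E) N} (hv : IsParallelAlong (leviCivita hB) c v)
    (hw : IsParallelAlong (leviCivita hB) c w) : B (v 1) (w 1) = B (v 0) (w 0) := by
  rw [isParallelAlong_leviCivita_iff] at hv hw
  refine bilinForm_eq_of_hasDerivWithinAt (E := E) B hv hw fun t => ?_
  have h := koszul_skew hs hB (maurerCartan (c t) (velocity c t)) (v t) (w t)
  have h1 : B (-(koszul hB (maurerCartan (c t) (velocity c t)) (v t))) (w t) +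
      B (v t) (-(koszul hB (maurerCartan (c t) (velocity c t)) (w t))) = 0 := by
    rw [map_neg, map_neg, LinearMap.neg_apply]
    linarith
  exact h1

theorem isParallelAlong_const (hB : B.Nondegenerate) {u : GroupLieAlgebra 𝓘(ℝ, E) N}
    (hu : ∀ x, koszul hB x u = 0) (c : ℝ → N) :
    IsParallelAlong (leviCivita hB) c fun _ => u := by
  rw [isParallelAlong_leviCivita_iff]
  intro t _
  rw [hu, neg_zero]
  exact hasDerivWithinAt_const (F := E) _ _ _

/-- A parallel left-invariant field is preserved by parallel transport. -/
theorem IsParallelTransport.map_leftInvariant (hs : B.IsSymm) (hB : B.Nondegenerate)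
    {u : GroupLieAlgebra 𝓘(ℝ, E) N} (hu : ∀ x, koszul hB x u = 0) {x y : N}
    {A : TangentSpace 𝓘(ℝ, E) x ≃ₗ[ℝ] TangentSpace 𝓘(ℝ, E) y}
    (h : IsParallelTransport (leviCivita hB) x y A) :
    A (leftTranslationEquiv (E := E) x u) = leftTranslationEquiv (E := E) y u := by
  induction h with
  | curve x y A c smooth source target parallel =>
    obtain ⟨w, hw, h0, h1⟩ := parallel (leftTranslationEquiv (E := E) x u)
    have hw0 : w 0 = u := (leftTranslationEquiv (E := E) x).injective h0
    -- Non-degeneracy replaces uniqueness for the parallel equation. Surjectivity of `A` makes any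
    -- `a` the endpoint of a parallel `v`, and both `w` and the constant field `u` have constant
    -- product with `v`; they agree at time `0`, hence `⟨w 1, a⟩ = ⟨u, a⟩`.
    have hw1 : w 1 = u := by
      refine eq_of_forall_form hB fun a => ?_
      obtain ⟨v, hv, _, h3⟩ := parallel (A.symm (leftTranslationEquiv (E := E) y a))
      rw [LinearEquiv.apply_symm_apply] at h3
      have hv1 : v 1 = a := (leftTranslationEquiv (E := E) y).injective h3
      have e1 := hw.form_eq hs hB hv
      have e2 := (isParallelAlong_const hB hu c).form_eq hs hB hv
      rw [← hv1, e1, e2, hw0]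
    rw [← h1, hw1]
    rfl
  | concat x y z A A' _ _ h1 h2 => rw [LinearEquiv.trans_apply, h1, h2]

/-- The maximal subspace on which the holonomy group acts trivially, for a two-step nilpotent Lie
group with non-degenerate center. -/
theorem holonomyFixed_eq_centralAnnihilator (hs : B.IsSymm) (hB : B.Nondegenerate)
    (hc : IsNondegenerateSubspace B (centerSubspace (GroupLieAlgebra 𝓘(ℝ, E) N)))
    (nil : ∀ X Y Z : GroupLieAlgebra 𝓘(ℝ, E) N, ⁅X, ⁅Y, Z⁆⁆ = 0) :
    holonomyFixed (leviCivita hB) (1 : N) = centralAnnihilator B := by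
  refine le_antisymm (fun u hu => ?_) fun u hu A hA => ?_
  · refine mem_centralAnnihilator_of_koszul_comm hs hB hc nil fun x z hz => ?_
    refine koszul_comm_of_mem_holonomyFixed hB hu ?_
    rw [← lie_skew, mem_centerSubspace_iff.1 hz, neg_zero]
  · have h := IsParallelTransport.map_leftInvariant hs hB
      (koszul_eq_zero_of_mem_centralAnnihilator hB hu) hA
    have h1 : leftTranslationEquiv (E := E) (1 : N) u = u := leftTranslationEquiv_one (E := E) u
    exact (congrArg A h1).symm.trans (h.trans h1)

end


theorem mainTheorem4
    {E : Type*} [NormedAddCommGroup E] [NormedSpace ℝ E] [FiniteDimensional ℝ E]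
    {N : Type*} [TopologicalSpace N] [ChartedSpace E N] [Group N] [LieGroup 𝓘(ℝ, E) ∞ N]
    [SimplyConnectedSpace N]
    (nilpotent : ∀ X Y Z : GroupLieAlgebra 𝓘(ℝ, E) N, ⁅X, ⁅Y, Z⁆⁆ = 0)
    (B : LinearMap.BilinForm ℝ (GroupLieAlgebra 𝓘(ℝ, E) N))
    (symm : B.IsSymm) (nondeg : B.Nondegenerate)
    (center_nondeg :
      IsNondegenerateSubspace B (centerSubspace (GroupLieAlgebra 𝓘(ℝ, E) N))) :
    Function.Injective (jMap symm nondeg center_nondeg) ↔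
      IsNondegenerateSubspace B (commutatorSubspace (GroupLieAlgebra 𝓘(ℝ, E) N)) ∧
        ¬ HasFlatDeRhamWuFactor nondeg := by
  have hV := holonomyFixed_eq_centralAnnihilator symm nondeg center_nondeg nilpotent
  rw [jMap_injective_iff, HasFlatDeRhamWuFactor, hV]
  constructor
  · intro h
    exact ⟨isNondegenerateSubspace_commutator symm nilpotent h, fun h' => h'.1 h⟩
  · rintro ⟨hc, h⟩
    -- A non-zero `V₀` would be non-degenerate, hence a flat factor.
    by_contra h'
    exact h ⟨h', isNondegenerateSubspace_centralAnnihilator symm nilpotent center_nondeg hc⟩
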